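/- **Setting.** A learner plays on the vertices (arms) of a finite undirected graph $G=(V,E)$, known in advance. An instance is a vector of means $\mu\in[0,1]^V$; in every round $t$ the arms have independent Gaussian rewards $r_{t,i}$ with means $\mu_i$ and variance $1/\sqrt2$. In round $t$ the learner chooses an arm $i_t$, possibly at random, on the basis of its earlier choices and observations, and observes the rewards of all arms in $N_{i_t}$, where $N_i$ consists of $i$ and its neighbours. Put $\mu^*=\max_i\mu_i$, $\Delta_i=\mu^*-\mu_i$, $I^*=\{i:\Delta_i=0\}$, let $\Delta_{\min}(\mu)$ be the smallest gap $\Delta_i$ with $i\notin I^*$, let $\mathrm{Reg}(T)=\mu^*T-\mathbb E\big[\sum_{t=1}^T r_{t,i_t}\big]$, and let $$c^*=c^*(G,\mu)=\min\Big\{\sum_{i\in V} x_i\Delta_i \;:\; x\in\mathbb R_{\ge0}^V,\ \sum_{j\in N_i}x_j\ge \frac1{\Delta_i^{2}}\ \text{ for all } i\in V\setminus I^*\Big\}.$$ The *reinforced wheel* $G_K$ has the $2K+1$ vertices $h$ (hub), $s_0,\dots,s_{K-1}$ (spokes) and $w_0,\dots,w_{K-1}$ (rim). With rim indices modulo $K$,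 its edges are $hs_i$, $s_iw_i$, $s_iw_{i+1}$ and $w_iw_{i+s}$ for $1\le s\le\lceil K^{1/8}\rceil$ (loops and repeated edges are discarded). **Theorem 1.** There are absolute constants $c>0$ and $C\ge1$ such that for every integer $K\ge1$ and every $\Delta_{\min}>0$ with $(\sqrt K+K^{1/4})\Delta_{\min}\le1$ the following holds on $G=G_K$. For every algorithm there is an instance $\mu\in[0,1]^V$ with a unique optimal arm and with $\Delta_{\min}(\mu)=\Delta_{\min}$ such that, for all integers $T\ge C\sqrt K/\Delta_{\min}^2$, $$\frac{\mathrm{Reg}(T)}{c^*\log T+\frac1{\Delta_{\min}}}\ \ge\ \frac{c\,K^{1/8}}{\log T}.$$ Consequently no algorithm achieves finite-time regret $O(c^*\log T)$, and the constant term of the regret can exceed $c^*\log T$ by a polynomial factor in $K$: for all real $B$ and $\varepsilon>0$ there is $K_0$ such that for every $K\ge K_0$ and every algorithm on $G_K$ there are an instance $\mu\in[0,1]^V$ with a unique optimal arm and $c^*>0$ and an integer $T\ge2$ with $$\mathrm{Reg}(T)\ \ge\ B\,c^*\log T+K^{1/8-\varepsilon}\,c^*\log T.$$ (So if $\mathrm{Reg}(T')\le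 B\,c^*\log T'+d$ for all $T'$, then $d\ge K^{1/8-\varepsilon}c^*\log T$.) -/

import Mathlib

open MeasureTheory ProbabilityTheory

noncomputable section

namespace FeedbackGraph

/-! ### Stochastic online learning with an undirected feedback graph -/

section Model

variable {V : Type*}

/-- Playing arm `i` reveals the reward of arm `j`: the neighbourhoods of the feedback graph carry
self-loops. -/
def Observes (G : SimpleGraph V) (i j : V) : Prop := j = i ∨ G.Adj i j

/-- The largest mean reward. -/
def bestMean (μ : V → ℝ) : ℝ := ⨆ i, μ i

/-- The gap of an arm to the largest mean reward. -/
def gap (μ : V → ℝ) (i : V) : ℝ := bestMean μ - μ i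

/-- Arm `i` has the largest mean reward. -/
def IsOptimalArm (μ : V → ℝ) (i : V) : Prop := ∀ j, μ j ≤ μ i

/-- `δ` is the smallest gap of a suboptimal arm. -/
def IsMinGap (μ : V → ℝ) (δ : ℝ) : Prop :=
  IsLeast {d : ℝ | ∃ i, ¬ IsOptimalArm μ i ∧ d = gap μ i} δ

open Classical in
/-- Feasible points of the linear program that defines `cstar`. -/
def IsFeasible [Fintype V] (G : SimpleGraph V) (μ : V → ℝ) (x : V → ℝ) : Prop :=
  (∀ i, 0 ≤ x i) ∧
    ∀ i, ¬ IsOptimalArm μ i →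
      1 / (gap μ i) ^ 2 ≤ ∑ j ∈ Finset.univ.filter (fun j => Observes G i j), x j

/-- The value of the linear program: minimize `⟨x, Δ⟩` over the feasible `x`. -/
def cstar [Fintype V] (G : SimpleGraph V) (μ : V → ℝ) : ℝ :=
  sInf {v : ℝ | ∃ x : V → ℝ, IsFeasible G μ x ∧ v = ∑ i, x i * gap μ i}

/-- The law of the reward vector of one round: independent Gaussian rewards with means `μ`
and variance `1 / √2`. -/
def rewardLaw [Fintype V] (μ : V → ℝ) : Measure (V → ℝ) :=
  Measure.pi fun i => gaussianReal (μ i) (NNReal.sqrt 2)⁻¹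

open Classical in
/-- What the learner sees of the reward vector `r` when playing arm `i`: the rewards of the arms
that `i` observes. The other coordinates are replaced by `0`. -/
def mask (G : SimpleGraph V) (i : V) (r : V → ℝ) : V → ℝ :=
  fun j => if Observes G i j then r j else 0

/-- What the learner records in one round: the arm played and the masked reward vector. -/
abbrev Round (V : Type*) : Type _ := V × (V → ℝ)

theorem measurable_snoc {X : Type*} [MeasurableSpace X] (t : ℕ) :
    Measurable (fun p : (Fin t → X) × X => (Fin.snoc p.1 p.2 : Fin (t + 1) → X)) := by
  refine measurable_pi_lambda _ fun i => ?_
  refine Fin.lastCases ?_ (fun j => ?_) i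
  · simpa using measurable_snd
  · simpa [Function.comp_def] using
      (measurable_pi_apply j).comp (measurable_fst (α := Fin t → X) (β := X))

theorem measurable_mask (G : SimpleGraph V) (i : V) : Measurable (mask G i) := by
  refine measurable_pi_lambda _ fun j => ?_
  by_cases h : Observes G i j
  · simpa [mask, h] using measurable_pi_apply j
  · simp [mask, h]

variable [MeasurableSpace V]

/-- A (randomized) algorithm: in round `t` it draws an arm from a distribution that depends
measurably on the `t` previous rounds. -/
structure Policy (V : Type*) [MeasurableSpace V] where
  /-- the distribution of the arm played in round `t`, given the history -/
  choose : (t : ℕ) → Kernel (Fin t → Round V) V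
  /-- it is a probability distribution -/
  markov : ∀ t, IsMarkovKernel (choose t)

instance (π : Policy V) (t : ℕ) : IsMarkovKernel (π.choose t) := π.markov t

variable [Fintype V] [MeasurableSingletonClass V]

instance (μ : V → ℝ) : IsProbabilityMeasure (rewardLaw μ) := by
  unfold rewardLaw; infer_instance

/-- The law of the feedback, given the arm played. -/
def feedback (G : SimpleGraph V) (μ : V → ℝ) : Kernel V (V → ℝ) :=
  Kernel.ofFunOfCountable fun i => (rewardLaw μ).map (mask G i)

instance (G : SimpleGraph V) (μ : V → ℝ) : IsMarkovKernel (feedback G μ) :=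
  ⟨fun i => Measure.isProbabilityMeasure_map (measurable_mask G i).aemeasurable⟩

/-- The law of the first `t` rounds of the interaction of the policy `π` with the instance `μ`. -/
def law (G : SimpleGraph V) (μ : V → ℝ) (π : Policy V) : (t : ℕ) → Measure (Fin t → Round V)
  | 0 => Measure.dirac Fin.elim0
  | t + 1 =>
    ((law G μ π t) ⊗ₘ
      ((π.choose t) ⊗ₖ (Kernel.prodMkLeft (Fin t → Round V) (feedback G μ)))).map
        fun p => Fin.snoc p.1 p.2

instance (G : SimpleGraph V) (μ : V → ℝ) (π : Policy V) (t : ℕ) :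
    IsProbabilityMeasure (law G μ π t) := by
  induction t with
  | zero => unfold law; infer_instance
  | succ t ih =>
    unfold law
    exact Measure.isProbabilityMeasure_map (measurable_snoc t).aemeasurable

/-- The pseudo-regret `μ* T - E[∑_{t ≤ T} r_{t, i_t}]`; the reward of the arm played is always
observed. -/
def regret (G : SimpleGraph V) (μ : V → ℝ) (π : Policy V) (T : ℕ) : ℝ :=
  bestMean μ * T - ∫ h, ∑ t : Fin T, (h t).2 (h t).1 ∂(law G μ π T)

end Model

/-! ### The reinforced wheel -/

/-- The `2 K + 1` vertices of the reinforced wheel: a hub, `K` spokes and `K` rim vertices. -/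
inductive Wheel (K : ℕ) : Type
  | hub : Wheel K
  | spoke : Fin K → Wheel K
  | rim : Fin K → Wheel K

namespace Wheel

/-- The vertices as a sum type. -/
def equivSum (K : ℕ) : Unit ⊕ Fin K ⊕ Fin K ≃ Wheel K where
  toFun
    | .inl _ => hub
    | .inr (.inl i) => spoke i
    | .inr (.inr i) => rim i
  invFun
    | hub => .inl ()
    | spoke i => .inr (.inl i)
    | rim i => .inr (.inr i)
  left_inv := by rintro (_ | _ | _) <;> rfl
  right_inv := by rintro (_ | _ | _) <;> rfl

instance (K : ℕ) : Fintype (Wheel K) := Fintype.ofEquiv _ (equivSum K)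

instance (K : ℕ) : MeasurableSpace (Wheel K) := ⊤

instance (K : ℕ) : DiscreteMeasurableSpace (Wheel K) := ⟨fun _ => trivial⟩

/-- The edges of the reinforced wheel, each in one direction: the hub is joined to every spoke,
the `i`-th spoke to the `i`-th and the `(i + 1)`-st rim vertex, and every rim vertex to the next
`⌈K ^ (1/8)⌉` rim vertices; rim vertices are counted cyclically. -/
inductive Edge (K : ℕ) : Wheel K → Wheel K → Prop
  | hub_spoke (i : Fin K) : Edge K hub (spoke i)
  | spoke_rim (i : Fin K) : Edge K (spoke i) (rim i)
  | spoke_rim_next (i j : Fin K) (h : (j : ℕ) = (i + 1) % K) : Edge K (spoke i) (rim j)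
  | rim_rim (i j : Fin K) (s : ℕ) (h1 : 1 ≤ s) (hs : s ≤ ⌈(K : ℝ) ^ (1 / 8 : ℝ)⌉₊)
      (h : (j : ℕ) = (i + s) % K) : Edge K (rim i) (rim j)

end Wheel

/-- The reinforced wheel on `2 K + 1` vertices. -/
def reinforcedWheel (K : ℕ) : SimpleGraph (Wheel K) := SimpleGraph.fromRel (Wheel.Edge K)

end FeedbackGraph

end

open FeedbackGraph

/-!
On the reinforced wheel a learner cannot know in advance how to explore the rim: spokes are the
cheap way in one instance, rim vertices (each of which reveals about `K ^ (1/8)` others) in another,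
and telling the two situations apart already costs more than `c*`.

Put `L = (√K + K ^ (1/4)) / 2` and `D = Δmin`. In the base instance the hub is optimal, the spokes
have gap `D` and the rim has gap `L D`. Exploring the rim through the spokes shows that `c*` is at
most `4 / D` (`Wheel.cstar_baseMean_le`). In the raised instance `i`, the rim vertex `i` lies `L D`
above the hub and its successor has gap `D`. Now spokes and rim cost about the same, so it is
better to explore through every `K ^ (1/8)`-th rim vertex, and `c*` is at most `10 K ^ (3/8) / D`
(`Wheel.cstar_peakMean_le`).

Consider the first `n`, about `1 / (100 D ^ 2)`, rounds. If the regret on the base instance is below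
a small multiple of `K ^ (1/8) / D`, the learner plays the rim so rarely that the rim vertices are
revealed, on average over `i`, much less than `1 / (L D) ^ 2` times. Then for some `i` the raised
instance cannot be recognized (`Wheel.exists_peakInfo_le`), the learner goes on playing hub and
spokes in it, and pays `L D` in at least half of the `n` rounds, of the order of `√K / D`
(`Wheel.le_regret_peakMean`). In either case the regret exceeds `c* + 1 / D` by a factor of order
`K ^ (1/8)` (`Wheel.exists_hard_instance`), and it can only grow with `T`.

The change of measure (`integral_law_le`) is elementary. Let `E` be the likelihood ratio of the
history under `μ'` to that under `μ`, and `Q` the one of the reflected instance `2 μ - μ'`. For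
Gaussian rewards `E * Q = exp (- S)`, where `S` is the sum of the squared differences of the
revealed means, divided by the variance. Hence `E + Q ≥ 2 - S`, and since `Q` has integral `1`, for
every function `g` of the history with values in `[0, 1]` the expectation under `μ'` is at most twice
the expectation under `μ`, plus the expectation of `S` under `μ`.

The second part of the theorem takes `D = 1 / (√K + K ^ (1/4))` and `T = ⌈√K / D ^ 2⌉`, for which
`log T` is only of order `log K`.
-/

open MeasureTheory ProbabilityTheory

noncomputable section

namespace FeedbackGraph

open scoped ENNReal

/-! ### Densities of product and Gaussian measures -/

section ProductDensity

/-- Densities multiply over independent coordinates. -/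
theorem pi_eq_withDensity {ι : Type*} [Fintype ι] {E : ι → Type*} [∀ i, MeasurableSpace (E i)]
    {ν ρ : ∀ i, Measure (E i)} [∀ i, IsProbabilityMeasure (ν i)] [∀ i, IsProbabilityMeasure (ρ i)]
    {f : ∀ i, E i → ℝ} (hf : ∀ i, Measurable (f i)) (hf0 : ∀ i x, 0 ≤ f i x)
    (h : ∀ i, ρ i = (ν i).withDensity fun x => ENNReal.ofReal (f i x)) :
    Measure.pi ρ = (Measure.pi ν).withDensity fun x => ENNReal.ofReal (∏ i, f i (x i)) := by
  classical
  have hint : ∀ i, Integrable (f i) (ν i) := by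
    intro i
    refine ⟨(hf i).aestronglyMeasurable, ?_⟩
    rw [hasFiniteIntegral_iff_ofReal (Filter.Eventually.of_forall (hf0 i))]
    have h1 : ρ i Set.univ = ∫⁻ x, ENNReal.ofReal (f i x) ∂(ν i) := by
      rw [h i, withDensity_apply _ MeasurableSet.univ, Measure.restrict_univ]
    rw [← h1]; exact measure_lt_top _ _
  refine Measure.pi_eq fun s hs => ?_
  have hind : ∀ x : ∀ i, E i, (Set.univ.pi s).indicator
      (fun x => ENNReal.ofReal (∏ i, f i (x i))) x
        = ENNReal.ofReal (∏ i, (s i).indicator (f i) (x i)) := by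
    intro x
    by_cases hx : x ∈ Set.univ.pi s
    · rw [Set.indicator_of_mem hx]
      congr 1
      exact Finset.prod_congr rfl fun i _ => by rw [Set.indicator_of_mem (hx i trivial)]
    · rw [Set.indicator_of_notMem hx]
      simp only [Set.mem_pi, Set.mem_univ, forall_const, not_forall] at hx
      obtain ⟨i, hi⟩ := hx
      rw [Finset.prod_eq_zero (Finset.mem_univ i) (Set.indicator_of_notMem hi _)]
      simp
  have hnn : ∀ i x, 0 ≤ (s i).indicator (f i) x := fun i x =>
    Set.indicator_nonneg (fun y _ => hf0 i y) x
  have hii : ∀ i, Integrable ((s i).indicator (f i)) (ν i) := fun i => (hint i).indicator (hs i)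
  rw [withDensity_apply _ (MeasurableSet.univ_pi hs),
    ← lintegral_indicator (MeasurableSet.univ_pi hs)]
  simp_rw [hind]
  rw [← ofReal_integral_eq_lintegral_ofReal (Integrable.fintype_prod_dep hii)
    (Filter.Eventually.of_forall fun x => Finset.prod_nonneg fun i _ => hnn i _),
    integral_fintype_prod_eq_prod (fun i => (s i).indicator (f i)),
    ENNReal.ofReal_prod_of_nonneg fun i _ => integral_nonneg (hnn i)]
  refine Finset.prod_congr rfl fun i _ => ?_
  rw [ofReal_integral_eq_lintegral_ofReal (hii i) (Filter.Eventually.of_forall (hnn i)), h i,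
    withDensity_apply _ (hs i), ← lintegral_indicator (hs i)]
  refine lintegral_congr fun x => ?_
  by_cases hx : x ∈ s i <;> simp [hx]

theorem gaussianReal_eq_withDensity (m m' : ℝ) {v : NNReal} (hv : v ≠ 0) :
    gaussianReal m' v = (gaussianReal m v).withDensity
      fun x => ENNReal.ofReal (Real.exp (((x - m) ^ 2 - (x - m') ^ 2) / (2 * v))) := by
  rw [gaussianReal_of_var_ne_zero _ hv, gaussianReal_of_var_ne_zero _ hv,
    ← withDensity_mul _ (measurable_gaussianPDF _ _) (by fun_prop)]
  congr 1
  ext x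
  simp only [Pi.mul_apply, gaussianPDF_def]
  rw [← ENNReal.ofReal_mul (gaussianPDFReal_nonneg _ _ _)]
  simp only [gaussianPDFReal_def]
  rw [mul_assoc _ (Real.exp _), ← Real.exp_add]
  congr 3
  ring

end ProductDensity

/-! ### Likelihood ratios of the interaction -/

section LogLikelihood

variable {V : Type*}

theorem observes_self (G : SimpleGraph V) (i : V) : Observes G i i := Or.inl rfl

variable [Fintype V] (G : SimpleGraph V) (μ μ' : V → ℝ)

open Classical in
/-- The log-likelihood ratio of the instance `μ'` to the instance `μ` of one round. Twice the
variance `1 / √2` is `√2`, hence the denominator. -/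
def roundLLR (p : Round V) : ℝ :=
  ∑ j, if Observes G p.1 j then ((p.2 j - μ j) ^ 2 - (p.2 j - μ' j) ^ 2) / √2 else 0

open Classical in
/-- The squared distance of the means of `μ` and `μ'`, over the arms that `a` observes, in units of
the variance `1 / √2`: twice the relative entropy of the feedback received on playing `a`. -/
def roundInfo (a : V) : ℝ := ∑ j, if Observes G a j then √2 * (μ' j - μ j) ^ 2 else 0

/-- The log-likelihood ratio of the instance `μ'` to the instance `μ` of a whole history. -/
def llr {t : ℕ} (h : Fin t → Round V) : ℝ := ∑ s, roundLLR G μ μ' (h s)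

theorem llr_snoc {t : ℕ} (h : Fin t → Round V) (p : Round V) :
    llr G μ μ' (Fin.snoc h p : Fin (t + 1) → Round V) = llr G μ μ' h + roundLLR G μ μ' p := by
  simp [llr, Fin.sum_univ_castSucc]

/-- The ratios of `μ'` and of its reflection `2 μ - μ'` in `μ` to `μ` multiply to a quantity that
depends on the arm played alone, not on the rewards. -/
theorem roundLLR_add_reflect (p : Round V) :
    roundLLR G μ μ' p + roundLLR G μ (2 * μ - μ') p = - roundInfo G μ μ' p.1 := by
  unfold roundLLR roundInfo
  rw [← Finset.sum_add_distrib, ← Finset.sum_neg_distrib]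
  refine Finset.sum_congr rfl fun j _ => ?_
  split_ifs
  · have h2 : √2 * √2 = 2 := Real.mul_self_sqrt (by norm_num)
    have : √2 ≠ 0 := by positivity
    simp only [Pi.sub_apply, Pi.mul_apply, Pi.ofNat_apply]
    field_simp
    rw [Real.sq_sqrt (by norm_num)]
    ring
  · simp

theorem roundInfo_nonneg (a : V) : 0 ≤ roundInfo G μ μ' a := by
  unfold roundInfo
  exact Finset.sum_nonneg fun j _ => by split_ifs <;> positivity

end LogLikelihood

section Interaction

variable {V : Type*} [MeasurableSpace V] [Fintype V] [MeasurableSingletonClass V]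
  (G : SimpleGraph V) (μ μ' : V → ℝ) (π : Policy V)

theorem measurable_roundLLR : Measurable (roundLLR G μ μ') := by
  have : ∀ a, Measurable fun o : V → ℝ => roundLLR G μ μ' (a, o) := by
    intro a
    unfold roundLLR
    refine Finset.measurable_sum _ fun j _ => ?_
    by_cases h : Observes G a j <;> simp only [h, if_true, if_false] <;> fun_prop
  exact measurable_from_prod_countable_right this

theorem sqrt_two_inv_ne_zero : (NNReal.sqrt 2)⁻¹ ≠ 0 := by simp

open Classical in
/-- Masked coordinates are deterministic, so the feedback is still a product measure. -/
theorem feedback_eq_pi (a : V) : feedback G μ a =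
    Measure.pi fun j => if Observes G a j then gaussianReal (μ j) (NNReal.sqrt 2)⁻¹
      else Measure.dirac 0 := by
  have hm : mask G a = fun r j => (fun x : ℝ => if Observes G a j then x else 0) (r j) := rfl
  have hme : ∀ j, Measurable fun x : ℝ => if Observes G a j then x else 0 := by
    intro j; by_cases h : Observes G a j <;> simp only [h, if_true, if_false] <;> fun_prop
  have : ∀ j, SigmaFinite ((gaussianReal (μ j) (NNReal.sqrt 2)⁻¹).map
      fun x : ℝ => if Observes G a j then x else 0) := fun j =>
    have := Measure.isProbabilityMeasure_map (μ := gaussianReal (μ j) (NNReal.sqrt 2)⁻¹)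
      (hme j).aemeasurable
    inferInstance
  change (rewardLaw μ).map (mask G a) = _
  rw [rewardLaw, hm, Measure.pi_map_pi fun j => (hme j).aemeasurable]
  congr 1
  ext1 j
  by_cases h : Observes G a j
  · simp [h]
  · simp [h, Measure.map_const]

theorem feedback_eq_withDensity (a : V) : feedback G μ' a = (feedback G μ a).withDensity
    fun o => ENNReal.ofReal (Real.exp (roundLLR G μ μ' (a, o))) := by
  classical
  rw [feedback_eq_pi, feedback_eq_pi]
  have hp : ∀ (m : V → ℝ) j, IsProbabilityMeasure
      (if Observes G a j then gaussianReal (m j) (NNReal.sqrt 2)⁻¹ else Measure.dirac 0) := by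
    intro m j; split_ifs <;> infer_instance
  have := hp μ
  have := hp μ'
  rw [pi_eq_withDensity (f := fun j x => Real.exp
    (if Observes G a j then ((x - μ j) ^ 2 - (x - μ' j) ^ 2) / √2 else 0))
    (ν := fun j => if Observes G a j then gaussianReal (μ j) (NNReal.sqrt 2)⁻¹
      else Measure.dirac 0)]
  · simp only [← Real.exp_sum]; rfl
  · intro j
    by_cases h : Observes G a j <;> simp only [h, if_true, if_false] <;> fun_prop
  · intro j x; positivity
  · intro j
    by_cases h : Observes G a j
    · simp only [h, if_true]
      rw [gaussianReal_eq_withDensity (μ j) (μ' j) sqrt_two_inv_ne_zero]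
      have : (2 * ((NNReal.sqrt 2)⁻¹ : NNReal) : ℝ) = √2 := by
        push_cast
        rw [← div_eq_mul_inv, Real.div_sqrt]
      rw [this]
    · simp [h]

/-- The law of a round given the history before it. -/
def roundKernel (t : ℕ) : Kernel (Fin t → Round V) (Round V) :=
  (π.choose t) ⊗ₖ (Kernel.prodMkLeft (Fin t → Round V) (feedback G μ))

instance (t : ℕ) : IsMarkovKernel (roundKernel G μ π t) := by
  unfold roundKernel; infer_instance

theorem law_succ (t : ℕ) : law G μ π (t + 1) =
    ((law G μ π t) ⊗ₘ roundKernel G μ π t).map fun p => Fin.snoc p.1 p.2 := rfl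

theorem lintegral_law_succ (t : ℕ) {f : (Fin (t + 1) → Round V) → ℝ≥0∞} (hf : Measurable f) :
    ∫⁻ h, f h ∂law G μ π (t + 1) =
      ∫⁻ h, ∫⁻ p, f (Fin.snoc h p) ∂(roundKernel G μ π t h) ∂law G μ π t := by
  rw [law_succ, lintegral_map hf (measurable_snoc t),
    Measure.lintegral_compProd (f := fun p => f (Fin.snoc p.1 p.2)) (hf.comp (measurable_snoc t))]

theorem lintegral_roundKernel (t : ℕ) (h : Fin t → Round V) {f : Round V → ℝ≥0∞}
    (hf : Measurable f) :
    ∫⁻ p, f p ∂(roundKernel G μ π t h) =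
      ∫⁻ a, ∫⁻ o, f (a, o) ∂(feedback G μ a) ∂(π.choose t h) := by
  rw [roundKernel, Kernel.lintegral_compProd _ _ _ hf]
  rfl

theorem measurable_llr (t : ℕ) : Measurable (llr G μ μ' (t := t)) := by
  unfold llr
  exact Finset.measurable_sum _ fun s _ =>
    (measurable_roundLLR G μ μ').comp (measurable_pi_apply s)

theorem lintegral_roundKernel_density (t : ℕ) (h : Fin t → Round V) {f : Round V → ℝ≥0∞}
    (hf : Measurable f) :
    ∫⁻ p, f p ∂(roundKernel G μ' π t h) =
      ∫⁻ p, ENNReal.ofReal (Real.exp (roundLLR G μ μ' p)) * f p ∂(roundKernel G μ π t h) := by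
  have hm := measurable_roundLLR G μ μ'
  rw [lintegral_roundKernel _ _ _ _ _ hf, lintegral_roundKernel _ _ _ _ _ (by fun_prop)]
  refine lintegral_congr fun a => ?_
  rw [feedback_eq_withDensity G μ μ' a, lintegral_withDensity_eq_lintegral_mul]
  · rfl
  · fun_prop
  · fun_prop

theorem lintegral_law_density (t : ℕ) {f : (Fin t → Round V) → ℝ≥0∞} (hf : Measurable f) :
    ∫⁻ h, f h ∂law G μ' π t =
      ∫⁻ h, ENNReal.ofReal (Real.exp (llr G μ μ' h)) * f h ∂law G μ π t := by
  induction t with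
  | zero => simp [law, llr]
  | succ t ih =>
    have hm := measurable_llr G μ μ' (t + 1)
    have hm' := measurable_llr G μ μ' t
    have hr := measurable_roundLLR G μ μ'
    have hs := measurable_snoc (X := Round V) t
    have hfs : Measurable fun p : (Fin t → Round V) × Round V =>
        f (Fin.snoc p.1 p.2 : Fin (t + 1) → Round V) := hf.comp hs
    rw [lintegral_law_succ _ _ _ _ hf, lintegral_law_succ _ _ _ _ (by fun_prop)]
    rw [ih (Measurable.lintegral_kernel_prod_right' hfs)]
    refine lintegral_congr fun h => ?_
    have hfh : Measurable fun p => f (Fin.snoc h p : Fin (t + 1) → Round V) :=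
      hfs.comp measurable_prodMk_left
    rw [lintegral_roundKernel_density G μ μ' _ _ _ hfh, ← lintegral_const_mul _ (by fun_prop)]
    refine lintegral_congr fun p => ?_
    rw [llr_snoc, Real.exp_add, ENNReal.ofReal_mul (Real.exp_nonneg _), mul_assoc]

/-- The policy does not know the instance, so its choices cancel in the likelihood ratio. -/
theorem law_eq_withDensity (t : ℕ) : law G μ' π t =
    (law G μ π t).withDensity fun h => ENNReal.ofReal (Real.exp (llr G μ μ' h)) := by
  have hm := measurable_llr G μ μ' t
  ext s hs
  rw [withDensity_apply _ hs, ← lintegral_indicator hs, ← lintegral_indicator_one hs,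
    lintegral_law_density G μ μ' π t (measurable_one.indicator hs)]
  refine lintegral_congr fun h => ?_
  by_cases hh : h ∈ s <;> simp [hh]

theorem integrable_exp_llr (t : ℕ) :
    Integrable (fun h => Real.exp (llr G μ μ' h)) (law G μ π t) ∧
      ∫ h, Real.exp (llr G μ μ' h) ∂law G μ π t = 1 := by
  have hm := measurable_llr G μ μ' t
  have h1 : ∫⁻ h, ENNReal.ofReal (Real.exp (llr G μ μ' h)) ∂law G μ π t = 1 := by
    have := lintegral_law_density G μ μ' π t (f := 1) measurable_one
    simpa using this.symm
  refine ⟨⟨(by fun_prop), ?_⟩, ?_⟩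
  · rw [hasFiniteIntegral_iff_ofReal (Filter.Eventually.of_forall fun _ => Real.exp_nonneg _), h1]
    exact ENNReal.one_lt_top
  · rw [integral_eq_lintegral_of_nonneg_ae
      (Filter.Eventually.of_forall fun _ => Real.exp_nonneg _) (by fun_prop), h1]
    rfl

end Interaction

/-! ### Change of measure and regret -/

section Regret

variable {V : Type*} [MeasurableSpace V] [Fintype V] [MeasurableSingletonClass V]
  (G : SimpleGraph V) (μ μ' : V → ℝ) (π : Policy V)

/-- Change of measure. With `E` and `Q` the likelihood ratios of `μ'` and of `2 μ - μ'` to `μ`, both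
of integral `1`, one has `log E + log Q = - S` for the total information `S`, so
`E + Q ≥ 2 + log E + log Q = 2 - S`. Integrating this against `1 - g` gives the bound. -/
theorem integral_law_le (t : ℕ) {g : (Fin t → Round V) → ℝ} (hg : Measurable g)
    (hg0 : ∀ h, 0 ≤ g h) (hg1 : ∀ h, g h ≤ 1) :
    ∫ h, g h ∂law G μ' π t ≤ 2 * ∫ h, g h ∂law G μ π t +
      ∫ h, ∑ s, roundInfo G μ μ' (h s).1 ∂law G μ π t := by
  set S : (Fin t → Round V) → ℝ := fun h => ∑ s, roundInfo G μ μ' (h s).1 with hS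
  have hS0 : ∀ h, 0 ≤ S h := fun h => Finset.sum_nonneg fun s _ => roundInfo_nonneg _ _ _ _
  have hSm : Measurable S := by
    refine Finset.measurable_sum _ fun s _ => ?_
    exact (measurable_of_countable (roundInfo G μ μ')).comp
      (measurable_fst.comp (measurable_pi_apply s))
  have hSi : Integrable S (law G μ π t) := by
    refine Integrable.of_bound hSm.aestronglyMeasurable
      (∑ _s : Fin t, ∑ a, roundInfo G μ μ' a) (Filter.Eventually.of_forall fun h => ?_)
    rw [Real.norm_of_nonneg (hS0 h)]
    refine Finset.sum_le_sum fun s _ => ?_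
    exact Finset.single_le_sum (f := roundInfo G μ μ')
      (fun a _ => roundInfo_nonneg _ _ _ _) (Finset.mem_univ _)
  have hgi : ∀ m, Integrable g (law G m π t) := fun m =>
    Integrable.of_bound hg.aestronglyMeasurable 1 (Filter.Eventually.of_forall fun h => by
      rw [Real.norm_of_nonneg (hg0 h)]; exact hg1 h)
  obtain ⟨hE, hE1⟩ := integrable_exp_llr G μ μ' π t
  obtain ⟨hQ, hQ1⟩ := integrable_exp_llr G μ (2 * μ - μ') π t
  set E := fun h : Fin t → Round V => Real.exp (llr G μ μ' h)
  set Q := fun h : Fin t → Round V => Real.exp (llr G μ (2 * μ - μ') h)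
  have hmE := measurable_llr G μ μ' t
  have hgE : Integrable (fun h => E h * g h) (law G μ π t) := by
    refine hE.mono' (by fun_prop) (Filter.Eventually.of_forall fun h => ?_)
    rw [Real.norm_of_nonneg (mul_nonneg (Real.exp_nonneg _) (hg0 h))]
    exact mul_le_of_le_one_right (Real.exp_nonneg _) (hg1 h)
  have hchange : ∫ h, g h ∂law G μ' π t = ∫ h, E h * g h ∂law G μ π t := by
    rw [law_eq_withDensity G μ μ', integral_withDensity_eq_integral_toReal_smul (by fun_prop)
      (Filter.Eventually.of_forall fun _ => ENNReal.ofReal_lt_top)]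
    refine integral_congr_ae (Filter.Eventually.of_forall fun h => ?_)
    simp only [smul_eq_mul, ENNReal.toReal_ofReal (Real.exp_nonneg _), E]
  have hpt : ∀ h, E h * g h ≤ E h - 2 + 2 * g h + S h + Q h := by
    intro h
    have hsum : llr G μ μ' h + llr G μ (2 * μ - μ') h = - S h := by
      simp only [llr, hS, ← Finset.sum_add_distrib, roundLLR_add_reflect, Finset.sum_neg_distrib]
    have hEQ : 2 - S h ≤ E h + Q h := by
      have h1 := Real.add_one_le_exp (llr G μ μ' h)
      have h2 := Real.add_one_le_exp (llr G μ (2 * μ - μ') h)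
      simp only [E, Q]; linarith
    have hQ0 : 0 ≤ Q h := Real.exp_nonneg _
    nlinarith [hg0 h, hg1 h, hS0 h, mul_nonneg (sub_nonneg.2 (hg1 h)) (sub_nonneg.2 hEQ),
      mul_nonneg (hg0 h) (hS0 h), mul_nonneg (hg0 h) hQ0]
  rw [hchange]
  have hI : Integrable (fun h => E h - 2 + 2 * g h + S h + Q h) (law G μ π t) :=
    (((hE.sub (integrable_const 2)).add ((hgi μ).const_mul 2)).add hSi).add hQ
  refine (integral_mono hgE hI hpt).trans_eq ?_
  rw [integral_add (by fun_prop) hQ, integral_add (by fun_prop) hSi, integral_add (by fun_prop)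
    (by fun_prop), integral_sub hE (by fun_prop), integral_const_mul, hE1, hQ1]
  simp
  ring

/-- The law of the arm played in round `t`. -/
def armLaw (t : ℕ) : Measure V := (law G μ π t).bind (π.choose t)

instance (t : ℕ) : IsProbabilityMeasure (armLaw G μ π t) := by
  unfold armLaw; infer_instance

theorem law_map_eval (T : ℕ) (s : Fin T) :
    (law G μ π T).map (fun h => h s) = armLaw G μ π s ⊗ₘ feedback G μ := by
  induction T with
  | zero => exact s.elim0
  | succ T ih =>
    rw [law_succ, Measure.map_map (measurable_pi_apply s) (measurable_snoc T)]
    refine Fin.lastCases ?_ (fun s => ?_) s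
    · have : ((fun h : Fin (T + 1) → Round V => h (Fin.last T)) ∘
          fun p : (Fin T → Round V) × Round V => (Fin.snoc p.1 p.2 : Fin (T + 1) → Round V))
          = Prod.snd := by ext1 p; simp
      rw [this]
      refine Measure.ext_of_lintegral _ fun f hf => ?_
      rw [lintegral_map hf measurable_snd, Measure.lintegral_compProd (by fun_prop),
        Measure.lintegral_compProd hf, armLaw,
        Measure.lintegral_bind (Kernel.aemeasurable _)
          (Measurable.lintegral_kernel_prod_right' hf).aemeasurable]
      exact lintegral_congr fun h => lintegral_roundKernel G μ π T h hf
    · have : ((fun h : Fin (T + 1) → Round V => h s.castSucc) ∘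
          fun p : (Fin T → Round V) × Round V => (Fin.snoc p.1 p.2 : Fin (T + 1) → Round V))
          = (fun h => h s) ∘ Prod.fst := by ext1 p; simp
      rw [this, ← Measure.map_map (measurable_pi_apply s) measurable_fst]
      have h2 := Measure.fst_compProd (law G μ π T) (roundKernel G μ π T)
      rw [Measure.fst] at h2
      rw [h2, ih]
      rfl

theorem integral_sum_rounds (T : ℕ) {r : Round V → ℝ}
    (hr : ∀ s, Integrable r (armLaw G μ π s ⊗ₘ feedback G μ)) :
    ∫ h, ∑ s : Fin T, r (h s) ∂law G μ π T =
      ∑ s ∈ Finset.range T, ∫ p, r p ∂(armLaw G μ π s ⊗ₘ feedback G μ) := by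
  have hr' : ∀ s : Fin T, Integrable r ((law G μ π T).map fun h => h s) := fun s => by
    rw [law_map_eval]; exact hr s
  rw [integral_finsetSum _ fun s _ =>
      show Integrable (fun h : Fin T → Round V => r (h s)) _ from
        (hr' s).comp_measurable (measurable_pi_apply s),
    ← Fin.sum_univ_eq_sum_range fun s => ∫ p, r p ∂(armLaw G μ π s ⊗ₘ feedback G μ)]
  refine Finset.sum_congr rfl fun s _ => ?_
  rw [← law_map_eval G μ π T s, integral_map (measurable_pi_apply s).aemeasurable
    (hr' s).aestronglyMeasurable]

theorem feedback_map_self (a : V) :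
    (feedback G μ a).map (fun o => o a) = gaussianReal (μ a) (NNReal.sqrt 2)⁻¹ := by
  change ((rewardLaw μ).map (mask G a)).map _ = _
  rw [Measure.map_map (measurable_pi_apply a) (measurable_mask G a)]
  have : (fun o : V → ℝ => o a) ∘ mask G a = Function.eval a := by
    ext o; simp [mask, observes_self]
  rw [this, rewardLaw, (measurePreserving_eval _ a).map_eq]

theorem integrable_reward_feedback (a : V) :
    Integrable (fun o : V → ℝ => o a) (feedback G μ a) ∧ ∫ o, o a ∂feedback G μ a = μ a := by
  have hi : Integrable id ((feedback G μ a).map fun o => o a) := by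
    rw [feedback_map_self]
    exact (memLp_id_gaussianReal 1).integrable le_rfl
  refine ⟨hi.comp_measurable (measurable_pi_apply a), ?_⟩
  have := integral_map (μ := feedback G μ a) (measurable_pi_apply a).aemeasurable
    hi.aestronglyMeasurable
  simp only [id] at this
  rw [← this, feedback_map_self, integral_id_gaussianReal]

theorem measurable_reward : Measurable fun p : Round V => p.2 p.1 :=
  measurable_from_prod_countable_right fun a => measurable_pi_apply a

theorem integrable_reward (t : ℕ) :
    Integrable (fun p : Round V => p.2 p.1) (armLaw G μ π t ⊗ₘ feedback G μ) := by
  rw [Measure.integrable_compProd_iff measurable_reward.aestronglyMeasurable]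
  exact ⟨Filter.Eventually.of_forall fun a => (integrable_reward_feedback G μ a).1,
    Integrable.of_finite⟩

theorem integral_arm_eq_sum (t : ℕ) (f : V → ℝ) :
    ∫ a, f a ∂armLaw G μ π t = ∑ a, (armLaw G μ π t).real {a} * f a := by
  rw [integral_fintype Integrable.of_finite]
  simp

theorem regret_eq (T : ℕ) : regret G μ π T =
    ∑ t ∈ Finset.range T, ∑ a, (armLaw G μ π t).real {a} * gap μ a := by
  rw [regret, integral_sum_rounds G μ π T (r := fun p => p.2 p.1)
    (integrable_reward G μ π)]
  have : bestMean μ * T = ∑ t ∈ Finset.range T, bestMean μ := by simp [mul_comm]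
  rw [this, ← Finset.sum_sub_distrib]
  refine Finset.sum_congr rfl fun t _ => ?_
  rw [Measure.integral_compProd (integrable_reward G μ π t)]
  simp only [(integrable_reward_feedback G μ _).2]
  rw [← integral_arm_eq_sum]
  simp only [gap]
  rw [integral_sub Integrable.of_finite Integrable.of_finite]
  simp

/-- The form of `integral_law_le` used below: it bounds the chance that the arm played in round `t`
lies in `A` under `μ'`. Only the rounds before `t` contribute information. -/
theorem sum_armLaw_le (t : ℕ) (A : Finset V) :
    ∑ a ∈ A, (armLaw G μ' π t).real {a} ≤ 2 * ∑ a ∈ A, (armLaw G μ π t).real {a} +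
      ∑ s ∈ Finset.range t, ∑ a, (armLaw G μ π s).real {a} * roundInfo G μ μ' a := by
  have hA : ∀ m, ∑ a ∈ A, (armLaw G m π t).real {a} =
      ∫ h, (π.choose t h).real A ∂law G m π t := by
    intro m
    rw [sum_measureReal_singleton, Measure.real, armLaw,
      Measure.bind_apply A.measurableSet (Kernel.aemeasurable _),
      integral_eq_lintegral_of_nonneg_ae (Filter.Eventually.of_forall fun _ => measureReal_nonneg)
        ((Kernel.measurable_coe _ A.measurableSet).ennreal_toReal).aestronglyMeasurable]
    congr 1
    refine lintegral_congr fun h => ?_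
    rw [ofReal_measureReal]
  rw [hA, hA]
  refine (integral_law_le G μ μ' π t ((Kernel.measurable_coe _ A.measurableSet).ennreal_toReal)
    (fun _ => measureReal_nonneg) fun _ => measureReal_le_one).trans_eq ?_
  congr 1
  have hi : ∀ s, Integrable (fun p : Round V => roundInfo G μ μ' p.1)
      (armLaw G μ π s ⊗ₘ feedback G μ) := by
    intro s
    have : Integrable (roundInfo G μ μ') (Measure.fst (armLaw G μ π s ⊗ₘ feedback G μ)) :=
      Integrable.of_finite
    exact this.comp_measurable measurable_fst
  rw [integral_sum_rounds G μ π t (r := fun p => roundInfo G μ μ' p.1) hi]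
  refine Finset.sum_congr rfl fun s _ => ?_
  rw [Measure.integral_compProd (hi s), ← integral_arm_eq_sum]
  simp

theorem sum_armLaw_univ (t : ℕ) : ∑ a, (armLaw G μ π t).real {a} = 1 := by
  simp

end Regret

/-! ### The linear program -/

section LinearProgram

variable {V : Type*} [Fintype V] {G : SimpleGraph V} {μ : V → ℝ}

theorem bestMean_eq {i : V} (hi : IsOptimalArm μ i) : bestMean μ = μ i :=
  le_antisymm (haveI : Nonempty V := ⟨i⟩; ciSup_le hi) (le_ciSup (Set.finite_range μ).bddAbove i)

theorem gap_nonneg (j : V) : 0 ≤ gap μ j :=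
  sub_nonneg.2 (le_ciSup (Set.finite_range μ).bddAbove j)

theorem cstar_le {x : V → ℝ} (hx : IsFeasible G μ x) : cstar G μ ≤ ∑ i, x i * gap μ i := by
  refine csInf_le ⟨0, ?_⟩ ⟨x, hx, rfl⟩
  rintro v ⟨y, hy, rfl⟩
  exact Finset.sum_nonneg fun i _ => mul_nonneg (hy.1 i) (gap_nonneg i)

open Classical in
theorem le_sum_observed {x : V → ℝ} (hx : ∀ i, 0 ≤ x i) {i j : V} (h : Observes G i j) :
    x j ≤ ∑ j ∈ Finset.univ.filter (fun j => Observes G i j), x j :=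
  Finset.single_le_sum (f := x) (fun k _ => hx k) (by simpa using h)

/-- If the optimal arm `i` does not reveal the suboptimal arm `j`, every feasible point pays for
revealing `j` with suboptimal plays. -/
theorem cstar_pos {i j : V} {δ : ℝ} (hδ : 0 < δ) (hgap : ∀ a, a ≠ i → δ ≤ gap μ a)
    (hj : ¬ IsOptimalArm μ j) (hgj : 0 < gap μ j) (hij : ¬ Observes G j i) :
    0 < cstar G μ := by
  classical
  have hpos : 0 < δ * (1 / gap μ j ^ 2) := by positivity
  refine hpos.trans_le (le_csInf ?_ ?_)
  · refine ⟨_, fun _ => ∑ a, 1 / gap μ a ^ 2, ⟨fun _ => ?_, fun a _ => ?_⟩, rfl⟩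
    · exact Finset.sum_nonneg fun a _ => by positivity
    · refine le_trans ?_ (le_sum_observed (i := a) (j := a) (fun _ => ?_) (observes_self G a))
      · exact Finset.single_le_sum (f := fun a => 1 / gap μ a ^ 2) (fun a _ => by positivity)
          (Finset.mem_univ a)
      · exact Finset.sum_nonneg fun a _ => by positivity
  · rintro v ⟨x, hx, rfl⟩
    calc δ * (1 / gap μ j ^ 2)
        ≤ δ * ∑ a ∈ Finset.univ.filter (fun a => Observes G j a), x a :=
          mul_le_mul_of_nonneg_left (hx.2 j hj) hδ.le
      _ = ∑ a ∈ Finset.univ.filter (fun a => Observes G j a), x a * δ := by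
          rw [mul_comm, Finset.sum_mul]
      _ ≤ ∑ a ∈ Finset.univ.filter (fun a => Observes G j a), x a * gap μ a := by
          refine Finset.sum_le_sum fun a ha => mul_le_mul_of_nonneg_left (hgap a ?_) (hx.1 a)
          rintro rfl
          exact hij (by simpa using ha)
      _ ≤ ∑ a, x a * gap μ a :=
          Finset.sum_le_sum_of_subset_of_nonneg (Finset.filter_subset _ _)
            fun a _ _ => mul_nonneg (hx.1 a) (gap_nonneg a)

end LinearProgram

/-! ### Neighbourhoods in the reinforced wheel -/

namespace Wheel

variable {K : ℕ}

theorem sum_eq (f : Wheel K → ℝ) :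
    ∑ a, f a = f hub + ∑ i, f (spoke i) + ∑ i, f (rim i) := by
  rw [← (equivSum K).sum_comp, Fintype.sum_sum_type, Fintype.sum_sum_type, ← add_assoc]
  simp [equivSum]

/-- The cyclic successor of a rim index. -/
def next (i : Fin K) : Fin K := ⟨(i + 1) % K, Nat.mod_lt _ (i.pos)⟩

theorem add_mod_injective (s : ℕ) {i j : Fin K} (h : ((i : ℕ) + s) % K = (j + s) % K) : i = j := by
  have h' : (i : ℕ) ≡ j [MOD K] := Nat.ModEq.add_right_cancel' s h
  have := h'.eq_of_lt_of_lt i.2 j.2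
  exact Fin.ext this

theorem next_injective : Function.Injective (next (K := K)) := fun i j h =>
  add_mod_injective 1 (by simpa [next, Fin.ext_iff] using h)

/-- The number of following rim vertices that a rim vertex is joined to. -/
def reach (K : ℕ) : ℕ := ⌈(K : ℝ) ^ (1 / 8 : ℝ)⌉₊

theorem not_observes_hub_rim (j : Fin K) : ¬ Observes (reinforcedWheel K) hub (rim j) := by
  rintro (h | ⟨-, h | h⟩) <;> cases h

theorem not_observes_rim_hub (j : Fin K) : ¬ Observes (reinforcedWheel K) (rim j) hub := by
  rintro (h | ⟨-, h | h⟩) <;> cases h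

theorem observes_spoke_hub (i : Fin K) : Observes (reinforcedWheel K) (spoke i) hub :=
  Or.inr ⟨by simp, Or.inr (Edge.hub_spoke i)⟩

theorem observes_rim_spoke (i : Fin K) : Observes (reinforcedWheel K) (rim i) (spoke i) :=
  Or.inr ⟨by simp, Or.inr (Edge.spoke_rim i)⟩

theorem eq_or_eq_of_observes_spoke_rim {i j : Fin K}
    (h : Observes (reinforcedWheel K) (spoke i) (rim j)) : j = i ∨ j = next i := by
  rcases h with h | ⟨-, h | h⟩
  · cases h
  · cases h with
    | spoke_rim => exact Or.inl rfl
    | spoke_rim_next _ _ h => exact Or.inr (Fin.ext h)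
  · cases h

theorem exists_of_observes_rim_rim {i j : Fin K}
    (h : Observes (reinforcedWheel K) (rim i) (rim j)) : j = i ∨
      ∃ s ∈ Finset.Icc 1 (reach K), (j : ℕ) = (i + s) % K ∨ (i : ℕ) = (j + s) % K := by
  rcases h with h | ⟨-, h | h⟩
  · exact Or.inl (by cases h; rfl)
  · cases h with
    | rim_rim _ _ s h1 hs h => exact Or.inr ⟨s, Finset.mem_Icc.2 ⟨h1, hs⟩, Or.inl h⟩
  · cases h with
    | rim_rim _ _ s h1 hs h => exact Or.inr ⟨s, Finset.mem_Icc.2 ⟨h1, hs⟩, Or.inr h⟩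

theorem observes_rim_rim {i j : Fin K} {s : ℕ} (hs : s ≤ reach K) (h : (i : ℕ) = (j + s) % K) :
    Observes (reinforcedWheel K) (rim i) (rim j) := by
  by_cases hij : j = i
  · exact Or.inl (by rw [hij])
  · refine Or.inr ⟨by simpa using fun h => hij h.symm, Or.inr (Edge.rim_rim j i s ?_ hs h)⟩
    by_contra h0
    obtain rfl : s = 0 := by omega
    exact hij (Fin.ext (by rw [h, add_zero, Nat.mod_eq_of_lt j.2]))

open Classical in
/-- The number of rim vertices that playing `a` reveals. -/
def rimCount (a : Wheel K) : ℕ :=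
  (Finset.univ.filter fun j : Fin K => Observes (reinforcedWheel K) a (rim j)).card

theorem rimCount_hub : rimCount (hub : Wheel K) = 0 := by
  simp [rimCount, not_observes_hub_rim]

theorem rimCount_spoke (i : Fin K) : rimCount (spoke i) ≤ 2 := by
  classical
  refine (Finset.card_le_card (t := {i, next i}) fun j hj => ?_).trans Finset.card_le_two
  simpa using eq_or_eq_of_observes_spoke_rim (by simpa using hj)

theorem rimCount_rim (i : Fin K) : rimCount (rim i) ≤ 1 + 2 * reach K := by
  classical
  have hsub : (Finset.univ.filter fun j : Fin K => Observes (reinforcedWheel K) (rim i) (rim j)) ⊆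
      {i} ∪ (Finset.Icc 1 (reach K)).biUnion fun s =>
        (Finset.univ.filter fun j : Fin K => (j : ℕ) = (i + s) % K) ∪
        (Finset.univ.filter fun j : Fin K => (i : ℕ) = (j + s) % K) := by
    intro j hj
    simpa using exists_of_observes_rim_rim (by simpa using hj)
  refine (Finset.card_le_card hsub).trans ((Finset.card_union_le _ _).trans ?_)
  rw [Finset.card_singleton]
  gcongr
  refine (Finset.card_biUnion_le_card_mul _ _ 2 fun s _ => ?_).trans (by simp [mul_comm])
  refine (Finset.card_union_le _ _).trans (add_le_add (b := 1) (d := 1) ?_ ?_)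
  · refine Finset.card_le_one.2 fun a ha b hb => ?_
    simp only [Finset.mem_filter_univ] at ha hb
    exact Fin.ext (ha.trans hb.symm)
  · refine Finset.card_le_one.2 fun a ha b hb => ?_
    simp only [Finset.mem_filter_univ] at ha hb
    exact add_mod_injective s (ha.symm.trans hb)

/-! ### The two kinds of instances -/

/-- The base instance: the hub is optimal, the spokes have gap `D` and the rim has gap `L * D`. The
means are shifted so that the smallest is `0`. -/
def baseMean (K : ℕ) (L D : ℝ) : Wheel K → ℝ
  | hub => L * D
  | spoke _ => L * D - D
  | rim _ => 0

open Classical in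
/-- The instance in which the rim vertex `i` is raised to the level `L * D` above the hub. Its
successor is raised to just below it, so that the smallest gap is `D`; for a single rim vertex the
two coincide and the first branch is taken. -/
def peakMean (L D : ℝ) (i : Fin K) : Wheel K → ℝ
  | hub => L * D
  | spoke _ => L * D - D
  | rim j => if j = i then 2 * L * D else if j = next i then 2 * L * D - D else 0

theorem isOptimalArm_and_unique {V : Type*} {μ : V → ℝ} {i : V} (h : ∀ j, j ≠ i → μ j < μ i) :
    IsOptimalArm μ i ∧ ∀ j, IsOptimalArm μ j → j = i := by
  refine ⟨fun j => ?_, fun j hj => by_contra fun hne => (h j hne).not_ge (hj i)⟩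
  by_cases hj : j = i
  · rw [hj]
  · exact (h j hj).le

section BaseInstance

variable {L D : ℝ}

theorem baseMean_lt (hL : 1 ≤ L) (hD : 0 < D) (a : Wheel K) (ha : a ≠ hub) :
    baseMean K L D a < baseMean K L D hub := by
  have : 0 < L * D := by positivity
  rcases a with _ | _ | _
  · exact absurd rfl ha
  all_goals simp only [baseMean]; linarith

theorem baseMean_mem_Icc (hL : 1 ≤ L) (hD : 0 < D) (hLD : 2 * L * D ≤ 1) (a : Wheel K) :
    baseMean K L D a ∈ Set.Icc (0 : ℝ) 1 := by
  have : D ≤ L * D := by nlinarith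
  rcases a with _ | _ | _ <;> simp only [baseMean, Set.mem_Icc] <;> constructor <;> linarith

theorem gap_baseMean (hL : 1 ≤ L) (hD : 0 < D) (a : Wheel K) :
    gap (baseMean K L D) a = L * D - baseMean K L D a := by
  rw [gap, bestMean_eq (isOptimalArm_and_unique (baseMean_lt hL hD)).1]; rfl

theorem isMinGap_baseMean (hL : 1 ≤ L) (hD : 0 < D) (hK : 1 ≤ K) :
    IsMinGap (baseMean K L D) D := by
  have hopt := isOptimalArm_and_unique (baseMean_lt (K := K) hL hD)
  have hLD : D ≤ L * D := by nlinarith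
  refine ⟨⟨spoke ⟨0, hK⟩, fun h => (by cases hopt.2 _ h), ?_⟩, ?_⟩
  · simp [gap_baseMean hL hD, baseMean]
  · rintro d ⟨a, ha, rfl⟩
    rw [gap_baseMean hL hD]
    rcases a with _ | _ | _
    · exact absurd hopt.1 ha
    all_goals simp only [baseMean]; linarith

theorem cstar_baseMean_pos (hL : 1 ≤ L) (hD : 0 < D) (hK : 1 ≤ K) :
    0 < cstar (reinforcedWheel K) (baseMean K L D) := by
  have hopt := isOptimalArm_and_unique (baseMean_lt (K := K) hL hD)
  refine cstar_pos (i := hub) (j := rim ⟨0, hK⟩) hD (fun a ha => ?_) (fun h => by cases hopt.2 _ h)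
    ?_ (not_observes_rim_hub _)
  · exact (isMinGap_baseMean hL hD hK).2 ⟨a, fun h => ha (hopt.2 _ h), rfl⟩
  · rw [gap_baseMean hL hD]
    simp only [baseMean]
    have : 0 < L * D := by positivity
    linarith

/-- Playing the hub is free and reveals the spokes; each spoke, at the small price `D`, reveals
the rim vertex of the same index. -/
theorem cstar_baseMean_le (hL : 1 ≤ L) (hD : 0 < D) :
    cstar (reinforcedWheel K) (baseMean K L D) ≤ K / (L ^ 2 * D) := by
  have hopt := isOptimalArm_and_unique (baseMean_lt (K := K) hL hD)
  let x : Wheel K → ℝ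
    | hub => 1 / D ^ 2
    | spoke _ => 1 / (L * D) ^ 2
    | rim _ => 0
  have hx : ∀ a, 0 ≤ x a := by
    rintro (_ | _ | _) <;> simp only [x] <;> positivity
  have hfeas : IsFeasible (reinforcedWheel K) (baseMean K L D) x := by
    refine ⟨hx, fun a ha => ?_⟩
    rw [gap_baseMean hL hD]
    rcases a with _ | i | i
    · exact absurd hopt.1 ha
    · refine le_trans (le_of_eq ?_) (le_sum_observed hx (observes_spoke_hub i))
      simp [x, baseMean]
    · refine le_trans (le_of_eq ?_) (le_sum_observed hx (observes_rim_spoke i))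
      simp [x, baseMean]
  refine (cstar_le hfeas).trans_eq ?_
  rw [sum_eq]
  simp only [x, gap_baseMean hL hD, baseMean]
  simp
  field_simp

end BaseInstance

section PeakInstance

variable {L D : ℝ}

theorem peakMean_lt (hL : 1 ≤ L) (hD : 0 < D) (i : Fin K) (a : Wheel K) (ha : a ≠ rim i) :
    peakMean L D i a < peakMean L D i (rim i) := by
  have : 0 < L * D := by positivity
  rcases a with _ | _ | j
  · simp only [peakMean, if_true]; linarith
  · simp only [peakMean, if_true]; linarith
  · have hj : j ≠ i := fun h => ha (by rw [h])
    simp only [peakMean, if_true, if_neg hj]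
    split_ifs <;> linarith

theorem peakMean_mem_Icc (hL : 1 ≤ L) (hD : 0 < D) (hLD : 2 * L * D ≤ 1) (i : Fin K)
    (a : Wheel K) : peakMean L D i a ∈ Set.Icc (0 : ℝ) 1 := by
  have : D ≤ L * D := by nlinarith
  rcases a with _ | _ | j <;> simp only [peakMean, Set.mem_Icc]
  · constructor <;> linarith
  · constructor <;> linarith
  · split_ifs <;> constructor <;> linarith

theorem gap_peakMean (hL : 1 ≤ L) (hD : 0 < D) (i : Fin K) (a : Wheel K) :
    gap (peakMean L D i) a = 2 * L * D - peakMean L D i a := by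
  rw [gap, bestMean_eq (isOptimalArm_and_unique (peakMean_lt hL hD i)).1]
  simp [peakMean]

theorem isMinGap_peakMean (hL : 1 ≤ L) (hD : 0 < D) (hK : K = 1 → L = 1) (i : Fin K) :
    IsMinGap (peakMean L D i) D := by
  have hopt := isOptimalArm_and_unique (peakMean_lt hL hD i)
  have hLD : D ≤ L * D := by nlinarith
  refine ⟨?_, ?_⟩
  -- For `K = 1` the optimal arm is its own successor, and the hub has gap `L * D = D`.
  · by_cases h1 : K = 1
    · refine ⟨hub, fun h => (by cases hopt.2 _ h), ?_⟩
      rw [gap_peakMean hL hD, hK h1]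
      simp only [peakMean]
      ring
    · have hne : next i ≠ i := by
        intro h
        have h2 : ((i : ℕ) + 1) % K = i := congrArg Fin.val h
        have h3 := i.2
        rcases Nat.lt_or_ge (i + 1) K with h4 | h4
        · rw [Nat.mod_eq_of_lt h4] at h2; omega
        · rw [show (i : ℕ) + 1 = K by omega, Nat.mod_self] at h2; omega
      refine ⟨rim (next i), fun h => ?_, ?_⟩
      · have := hopt.2 _ h
        simp only [rim.injEq] at this
        exact hne this
      · simp [gap_peakMean hL hD, peakMean, hne]
  · rintro d ⟨a, ha, rfl⟩
    rw [gap_peakMean hL hD]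
    rcases a with _ | _ | j
    · simp only [peakMean]; linarith
    · simp only [peakMean]; linarith
    · have hj : j ≠ i := fun h => ha (by rw [h]; exact hopt.1)
      simp only [peakMean, if_neg hj]
      split_ifs <;> linarith

theorem cstar_peakMean_pos (hL : 1 ≤ L) (hD : 0 < D) (hK : K = 1 → L = 1) (i : Fin K) :
    0 < cstar (reinforcedWheel K) (peakMean L D i) := by
  have hopt := isOptimalArm_and_unique (peakMean_lt hL hD i)
  refine cstar_pos (i := rim i) (j := hub) hD (fun a ha => ?_) (fun h => by cases hopt.2 _ h)
    ?_ (not_observes_hub_rim _)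
  · exact (isMinGap_peakMean hL hD hK i).2 ⟨a, fun h => ha (hopt.2 _ h), rfl⟩
  · rw [gap_peakMean hL hD]
    simp only [peakMean]
    have : 0 < L * D := by positivity
    linarith

theorem card_filter_dvd_le (m : ℕ) :
    (Finset.univ.filter fun j : Fin K => m ∣ j).card ≤ K / m + 1 := by
  rw [← Finset.card_range (K / m + 1)]
  refine Finset.card_le_card_of_injOn (fun j => (j : ℕ) / m) (fun j _ => ?_) fun j hj j' hj' h => ?_
  · simpa using Nat.lt_succ_of_le (Nat.div_le_div_right j.2.le)
  · simp only [Finset.coe_filter_univ, Set.mem_ofPred_eq] at hj hj'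
    refine Fin.ext ?_
    rw [← Nat.div_mul_cancel hj, ← Nat.div_mul_cancel hj']
    exact congrArg (· * m) h

theorem one_le_reach (hK : 1 ≤ K) : 1 ≤ reach K :=
  Nat.one_le_ceil_iff.2 (by positivity)

/-- All prices except that of `rim i` are of order `L * D`, so it is best to reveal the rim through
the rim vertices whose index is a multiple of `reach K`. -/
theorem cstar_peakMean_le (hL : 1 ≤ L) (hD : 0 < D) (i : Fin K) :
    cstar (reinforcedWheel K) (peakMean L D i) ≤ (2 * (K / reach K : ℕ) + 3) / (L * D) := by
  classical
  have hLD : D ≤ L * D := by nlinarith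
  have hm : 1 ≤ reach K := one_le_reach (by have := i.2; omega)
  have hopt := isOptimalArm_and_unique (peakMean_lt hL hD i)
  -- Plays of `rim i` are free and take care of its successor, whose gap is only `D`.
  let x : Wheel K → ℝ
    | hub => 1 / (L * D) ^ 2
    | spoke _ => 0
    | rim j => (if reach K ∣ j then 1 / (L * D) ^ 2 else 0) + if j = i then 1 / D ^ 2 else 0
  have hx : ∀ a, 0 ≤ x a := by
    rintro (_ | _ | _)
    · simp only [x]; positivity
    · simp only [x]; exact le_rfl
    · simp only [x]
      apply add_nonneg <;> split_ifs <;> positivity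
  have hfeas : IsFeasible (reinforcedWheel K) (peakMean L D i) x := by
    refine ⟨hx, fun a ha => ?_⟩
    rw [gap_peakMean hL hD]
    rcases a with _ | j | j
    · refine le_trans (le_of_eq ?_) (le_sum_observed hx (observes_self _ hub))
      simp only [x, peakMean]; ring
    · refine le_trans ?_ (le_sum_observed hx (observes_spoke_hub j))
      simp only [x, peakMean]
      gcongr
      linarith
    · have hj : j ≠ i := fun h => ha (by rw [h]; exact hopt.1)
      simp only [peakMean, if_neg hj]
      split_ifs with hn
      · refine le_trans ?_ (le_sum_observed hx
          (observes_rim_rim (i := j) (j := i) hm (by rw [hn]; rfl)))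
        simp only [x, if_true]
        rw [sub_sub_cancel]
        refine le_add_of_nonneg_left ?_
        split_ifs <;> positivity
      -- The last multiple of `reach K` up to `j` reveals `j`.
      · have hlt : (j : ℕ) - j % reach K < K := (Nat.sub_le _ _).trans_lt j.2
        refine le_trans ?_ (le_sum_observed hx
          (observes_rim_rim (s := j % reach K) (i := j) (j := ⟨j - j % reach K, hlt⟩)
            (Nat.mod_lt _ hm).le ?_))
        · simp only [x]
          rw [if_pos (Nat.dvd_sub_mod _)]
          refine le_add_of_le_of_nonneg ?_ (by split_ifs <;> positivity)
          gcongr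
          linarith
        · simp only
          rw [Nat.sub_add_cancel (Nat.mod_le _ _), Nat.mod_eq_of_lt j.2]
  refine (cstar_le hfeas).trans ?_
  rw [sum_eq]
  have hrim : ∀ j : Fin K, x (rim j) * gap (peakMean L D i) (rim j) ≤
      if reach K ∣ j then 2 / (L * D) else 0 := by
    intro j
    rw [gap_peakMean hL hD]
    by_cases hj : j = i
    · simp only [peakMean, if_pos hj, sub_self, mul_zero]
      split_ifs <;> positivity
    · simp only [x, if_neg hj, add_zero]
      have hle : 2 * L * D - peakMean L D i (rim j) ≤ 2 * (L * D) := by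
        simp only [peakMean]
        split_ifs <;> nlinarith
      split_ifs
      · refine (mul_le_mul_of_nonneg_left hle (by positivity)).trans_eq ?_
        field_simp
      · simp
  have hsum : ∑ j : Fin K, x (rim j) * gap (peakMean L D i) (rim j) ≤
      ((K / reach K : ℕ) + 1) * (2 / (L * D)) := by
    refine (Finset.sum_le_sum fun j _ => hrim j).trans ?_
    rw [← Finset.sum_filter, Finset.sum_const, nsmul_eq_mul]
    gcongr
    exact_mod_cast card_filter_dvd_le (reach K)
  have hhub : x hub * gap (peakMean L D i) hub = 1 / (L * D) := by
    rw [gap_peakMean hL hD]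
    simp only [x, peakMean]
    field_simp
    ring
  have hspoke : ∑ j : Fin K, x (spoke j) * gap (peakMean L D i) (spoke j) = 0 := by simp [x]
  rw [hhub, hspoke]
  refine (add_le_add_right hsum _).trans_eq ?_
  ring

/-- Each revealed rim vertex distinguishes the base instance from only two of the raised ones. -/
theorem sum_roundInfo_le (hL : 1 ≤ L) (hD : 0 < D) (a : Wheel K) :
    ∑ i, roundInfo (reinforcedWheel K) (baseMean K L D) (peakMean L D i) a ≤
      12 * (L * D) ^ 2 * rimCount a := by
  classical
  have hLD : D ≤ L * D := by nlinarith
  have h2 : √2 * 8 ≤ 12 := by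
    have : √2 ≤ 1.5 := Real.sqrt_le_iff.2 ⟨by norm_num, by norm_num⟩
    linarith
  have hpt : ∀ i j : Fin K, √2 * (peakMean L D i (rim j) - baseMean K L D (rim j)) ^ 2 ≤
      6 * (L * D) ^ 2 * ((if j = i then 1 else 0) + if j = next i then 1 else 0) := by
    intro i j
    have hd : (peakMean L D i (rim j) - baseMean K L D (rim j)) ^ 2 ≤
        4 * (L * D) ^ 2 * ((if j = i then 1 else 0) + if j = next i then 1 else 0) := by
      simp only [peakMean, baseMean, sub_zero]
      split_ifs <;> nlinarith
    have h0 : (0 : ℝ) ≤ (L * D) ^ 2 * ((if j = i then 1 else 0) + if j = next i then 1 else 0) := by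
      apply mul_nonneg (by positivity)
      split_ifs <;> norm_num
    calc _ ≤ √2 * (4 * (L * D) ^ 2 * ((if j = i then 1 else 0) + if j = next i then 1 else 0)) :=
          mul_le_mul_of_nonneg_left hd (by positivity)
      _ ≤ _ := by nlinarith
  have hinfo : ∀ i : Fin K, roundInfo (reinforcedWheel K) (baseMean K L D) (peakMean L D i) a ≤
      ∑ j ∈ Finset.univ.filter (fun j : Fin K => Observes (reinforcedWheel K) a (rim j)),
        6 * (L * D) ^ 2 * ((if j = i then 1 else 0) + if j = next i then 1 else 0) := by
    intro i
    rw [roundInfo, sum_eq]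
    simp only [peakMean, baseMean, sub_self]
    simp only [ne_eq, OfNat.ofNat_ne_zero, not_false_eq_true, zero_pow, mul_zero, ite_self,
      Finset.sum_const_zero, zero_add]
    rw [← Finset.sum_filter]
    exact Finset.sum_le_sum fun j _ => hpt i j
  refine (Finset.sum_le_sum fun i _ => hinfo i).trans ?_
  rw [Finset.sum_comm, rimCount, mul_comm (12 * (L * D) ^ 2), ← nsmul_eq_mul]
  refine Finset.sum_le_card_nsmul _ _ _ fun j _ => ?_
  rw [← Finset.mul_sum, Finset.sum_add_distrib]
  have h1 : ∑ i : Fin K, (if j = i then (1 : ℝ) else 0) = 1 := by simp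
  have h3 : ∑ i : Fin K, (if j = next i then (1 : ℝ) else 0) ≤ 1 := by
    rw [Finset.sum_boole]
    norm_cast
    refine Finset.card_le_one.2 fun b hb c hc => next_injective ?_
    simp only [Finset.mem_filter_univ] at hb hc
    rw [← hb, ← hc]
  nlinarith [sq_nonneg (L * D)]

end PeakInstance

end Wheel

theorem regret_mono {V : Type*} [MeasurableSpace V] [Fintype V] [MeasurableSingletonClass V]
    (G : SimpleGraph V) (μ : V → ℝ) (π : Policy V) {n T : ℕ} (h : n ≤ T) :
    regret G μ π n ≤ regret G μ π T := by
  rw [regret_eq, regret_eq]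
  refine Finset.sum_le_sum_of_subset_of_nonneg (Finset.range_mono h) fun t _ _ => ?_
  exact Finset.sum_nonneg fun a _ => mul_nonneg measureReal_nonneg (gap_nonneg a)

/-! ### The lower bound on the wheel -/

namespace Wheel

variable {K : ℕ} {L D : ℝ}

/-- The expected number of plays of rim vertices in the first `n` rounds of the base instance. -/
def rimPlays (π : Policy (Wheel K)) (L D : ℝ) (n : ℕ) : ℝ :=
  ∑ t ∈ Finset.range n, ∑ i,
    (armLaw (reinforcedWheel K) (baseMean K L D) π t).real {rim i}

theorem rimPlays_mono (π : Policy (Wheel K)) {n T : ℕ} (h : n ≤ T) :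
    rimPlays π L D n ≤ rimPlays π L D T :=
  Finset.sum_le_sum_of_subset_of_nonneg (Finset.range_mono h) fun _ _ _ =>
    Finset.sum_nonneg fun _ _ => measureReal_nonneg

theorem mul_rimPlays_le_regret (hL : 1 ≤ L) (hD : 0 < D) (π : Policy (Wheel K)) (n : ℕ) :
    L * D * rimPlays π L D n ≤ regret (reinforcedWheel K) (baseMean K L D) π n := by
  rw [regret_eq, rimPlays, Finset.mul_sum]
  refine Finset.sum_le_sum fun t _ => ?_
  rw [sum_eq, Finset.mul_sum]
  refine le_add_of_nonneg_of_le (add_nonneg ?_ (Finset.sum_nonneg fun i _ => ?_)) (le_of_eq ?_)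
  · exact mul_nonneg measureReal_nonneg (gap_nonneg _)
  · exact mul_nonneg measureReal_nonneg (gap_nonneg _)
  · refine Finset.sum_congr rfl fun i _ => ?_
    rw [gap_baseMean hL hD, mul_comm]
    simp [baseMean]

/-- The expected information of `N` rounds of the base instance about raising `i`. -/
def peakInfo (π : Policy (Wheel K)) (L D : ℝ) (N : ℕ) (i : Fin K) : ℝ :=
  ∑ s ∈ Finset.range N, ∑ a, (armLaw (reinforcedWheel K) (baseMean K L D) π s).real {a} *
    roundInfo (reinforcedWheel K) (baseMean K L D) (peakMean L D i) a

theorem peakInfo_mono (π : Policy (Wheel K)) (i : Fin K) {n T : ℕ} (h : n ≤ T) :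
    peakInfo π L D n i ≤ peakInfo π L D T i :=
  Finset.sum_le_sum_of_subset_of_nonneg (Finset.range_mono h) fun _ _ _ =>
    Finset.sum_nonneg fun _ _ => mul_nonneg measureReal_nonneg (roundInfo_nonneg _ _ _ _)

/-- By averaging over `i`: a spoke reveals at most two rim vertices, a rim vertex at most
`2 * reach K + 1`. -/
theorem exists_peakInfo_le (hL : 1 ≤ L) (hD : 0 < D) (hK : 1 ≤ K) (π : Policy (Wheel K)) (N : ℕ) :
    ∃ i, peakInfo π L D N i ≤
      12 * (L * D) ^ 2 * (2 * N + (2 * reach K + 1) * rimPlays π L D N) / K := by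
  have hK' : (0 : ℝ) < K := by exact_mod_cast hK
  have hne : (Finset.univ : Finset (Fin K)).Nonempty := ⟨⟨0, hK⟩, Finset.mem_univ _⟩
  suffices h : ∑ i, peakInfo π L D N i ≤
      ∑ _i : Fin K, 12 * (L * D) ^ 2 * (2 * N + (2 * reach K + 1) * rimPlays π L D N) / K by
    obtain ⟨i, -, hi⟩ := Finset.exists_le_of_sum_le hne h
    exact ⟨i, hi⟩
  rw [Finset.sum_const, Finset.card_univ, Fintype.card_fin, nsmul_eq_mul,
    mul_div_cancel₀ _ hK'.ne']
  simp only [peakInfo]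
  rw [Finset.sum_comm]
  have hround : ∀ s, ∑ i : Fin K, ∑ a,
      (armLaw (reinforcedWheel K) (baseMean K L D) π s).real {a} *
        roundInfo (reinforcedWheel K) (baseMean K L D) (peakMean L D i) a ≤
      12 * (L * D) ^ 2 * (2 + (2 * reach K + 1) *
        ∑ i, (armLaw (reinforcedWheel K) (baseMean K L D) π s).real {rim i}) := by
    intro s
    set p := fun a => (armLaw (reinforcedWheel K) (baseMean K L D) π s).real {a} with hp
    have hp0 : ∀ a, 0 ≤ p a := fun a => measureReal_nonneg
    have hp1 : ∑ a, p a = 1 := sum_armLaw_univ _ _ _ _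
    rw [sum_eq] at hp1
    have hspoke : ∑ i : Fin K, p (spoke i) ≤ 1 := by
      have := Finset.sum_nonneg fun (i : Fin K) (_ : i ∈ Finset.univ) => hp0 (rim i)
      linarith [hp0 hub]
    calc ∑ i : Fin K, ∑ a, p a *
          roundInfo (reinforcedWheel K) (baseMean K L D) (peakMean L D i) a
        = ∑ a, p a *
          ∑ i, roundInfo (reinforcedWheel K) (baseMean K L D) (peakMean L D i) a := by
          rw [Finset.sum_comm]; simp only [Finset.mul_sum]
      _ ≤ ∑ a, p a * (12 * (L * D) ^ 2 * rimCount a) :=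
          Finset.sum_le_sum fun a _ => mul_le_mul_of_nonneg_left (sum_roundInfo_le hL hD a) (hp0 a)
      _ = 12 * (L * D) ^ 2 * ∑ a, p a * rimCount a := by
          rw [Finset.mul_sum]; exact Finset.sum_congr rfl fun a _ => by ring
      _ ≤ 12 * (L * D) ^ 2 * (∑ i : Fin K, p (spoke i) * 2 +
            ∑ i : Fin K, p (rim i) * (2 * reach K + 1)) := by
          refine mul_le_mul_of_nonneg_left ?_ (by positivity)
          rw [sum_eq, rimCount_hub, Nat.cast_zero, mul_zero, zero_add]
          refine add_le_add (Finset.sum_le_sum fun i _ => ?_) (Finset.sum_le_sum fun i _ => ?_)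
          · exact mul_le_mul_of_nonneg_left (by exact_mod_cast rimCount_spoke i) (hp0 _)
          · refine mul_le_mul_of_nonneg_left ?_ (hp0 _)
            have := rimCount_rim i
            rw [add_comm] at this
            exact_mod_cast this
      _ ≤ _ := by
          rw [← Finset.sum_mul, ← Finset.sum_mul]
          refine mul_le_mul_of_nonneg_left ?_ (by positivity)
          linarith
  refine (Finset.sum_le_sum fun s _ => hround s).trans_eq ?_
  rw [← Finset.mul_sum, Finset.sum_add_distrib, ← Finset.mul_sum, rimPlays]
  simp [mul_comm]

/-- Outside of `rim i` and its successor all gaps of the raised instance are at least `L * D`, and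
the plays of these two are carried over from the base instance. -/
theorem le_regret_peakMean (hL : 1 ≤ L) (hD : 0 < D) (π : Policy (Wheel K)) (i : Fin K) (N : ℕ) :
    L * D * ((N + 1) - 2 * rimPlays π L D (N + 1) - (N + 1) * peakInfo π L D N i) ≤
      regret (reinforcedWheel K) (peakMean L D i) π (N + 1) := by
  classical
  have hLD : D ≤ L * D := by nlinarith
  set G := reinforcedWheel K
  set A : Finset (Wheel K) := {rim i, rim (next i)} with hA
  have hgap : ∀ a ∈ Aᶜ, L * D ≤ gap (peakMean L D i) a := by
    intro a ha
    rw [gap_peakMean hL hD]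
    rcases a with _ | _ | j
    · simp only [peakMean]; linarith
    · simp only [peakMean]; linarith
    · simp only [hA, Finset.mem_compl, Finset.mem_insert, Finset.mem_singleton, rim.injEq,
        not_or] at ha
      simp only [peakMean, if_neg ha.1, if_neg ha.2]
      linarith
  have hround : ∀ t ∈ Finset.range (N + 1),
      L * D * (1 - 2 * ∑ j, (armLaw G (baseMean K L D) π t).real {rim j} - peakInfo π L D N i) ≤
        ∑ a, (armLaw G (peakMean L D i) π t).real {a} * gap (peakMean L D i) a := by
    intro t ht
    have h1 := sum_armLaw_le G (baseMean K L D) (peakMean L D i) π t A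
    have h2 : ∑ a ∈ A, (armLaw G (baseMean K L D) π t).real {a} ≤
        ∑ j, (armLaw G (baseMean K L D) π t).real {rim j} := by
      rw [← Finset.sum_image (s := Finset.univ) (g := (rim : Fin K → Wheel K))
        (f := fun a => (armLaw G (baseMean K L D) π t).real {a}) (fun a _ b _ h => by simpa using h)]
      refine Finset.sum_le_sum_of_subset_of_nonneg ?_ fun _ _ _ => measureReal_nonneg
      intro a ha
      simp only [hA, Finset.mem_insert, Finset.mem_singleton] at ha
      rcases ha with rfl | rfl <;> simp
    have h3 := peakInfo_mono (L := L) (D := D) π i (Finset.mem_range_succ_iff.1 ht)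
    have h4 : ∑ a ∈ A, (armLaw G (peakMean L D i) π t).real {a} +
        ∑ a ∈ Aᶜ, (armLaw G (peakMean L D i) π t).real {a} = 1 := by
      rw [Finset.sum_add_sum_compl, sum_armLaw_univ]
    have h5 : L * D * ∑ a ∈ Aᶜ, (armLaw G (peakMean L D i) π t).real {a} ≤
        ∑ a, (armLaw G (peakMean L D i) π t).real {a} * gap (peakMean L D i) a := by
      rw [Finset.mul_sum]
      refine (Finset.sum_le_sum fun a ha => ?_).trans
        (Finset.sum_le_sum_of_subset_of_nonneg (Finset.subset_univ Aᶜ) fun a _ _ =>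
          mul_nonneg measureReal_nonneg (gap_nonneg a))
      rw [mul_comm]
      exact mul_le_mul_of_nonneg_left (hgap a ha) measureReal_nonneg
    refine le_trans (mul_le_mul_of_nonneg_left ?_ (hD.le.trans hLD)) h5
    unfold peakInfo at h3 ⊢
    linarith
  rw [regret_eq]
  refine le_trans (le_of_eq ?_) (Finset.sum_le_sum hround)
  rw [← Finset.mul_sum, Finset.sum_sub_distrib, Finset.sum_sub_distrib, ← Finset.mul_sum, rimPlays]
  simp [G]

/-- The numerical core, with `k = K ^ (1 / 8)` and `R` the number of rim plays in `N + 1` rounds: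
if the regret on the base instance is below `k / (2000 D)`, the correction terms of
`le_regret_peakMean` consume at most half of the `N + 1` rounds. -/
theorem half_le_of_rimPlays_le {k : ℝ} (hk : 1 ≤ k) (hkK : k ^ 8 = K)
    (hreach : (reach K : ℝ) ≤ k + 1) (hLk : L = (k ^ 4 + k ^ 2) / 2) (hD : 0 < D) {N : ℕ} {R : ℝ}
    (hR0 : 0 ≤ R) (hR : L * D * R ≤ 1 / 2000 * k / D) (hN : N ≤ 1 / 100 / D ^ 2)
    (hN' : 1 / 100 / D ^ 2 ≤ N + 1) :
    (N + 1 : ℝ) / 2 ≤ (N + 1) - 2 * R -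
      (N + 1) * (12 * (L * D) ^ 2 * (2 * N + (2 * reach K + 1) * R) / K) := by
  have hk2 : 1 ≤ k ^ 2 := one_le_pow₀ hk
  have hk4 : k ^ 2 ≤ k ^ 4 := pow_le_pow_right₀ hk (by norm_num)
  have hkk : k ≤ k ^ 2 := by nlinarith
  have hkL : k ^ 2 ≤ L := by linarith
  have hL4 : L ≤ k ^ 4 := by linarith
  have hL0 : 0 < L := by linarith
  have hK0 : (0 : ℝ) < K := by rw [← hkK]; positivity
  have hRD : L * (R * D ^ 2) ≤ 1 / 2000 * k := by
    rw [le_div_iff₀ hD] at hR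
    nlinarith
  have hND : N * D ^ 2 ≤ 1 / 100 := (le_div_iff₀ (by positivity)).1 hN
  have hND' : 1 / 100 ≤ (N + 1) * D ^ 2 := (div_le_iff₀ (by positivity)).1 hN'
  have hX0 : 0 ≤ R * D ^ 2 := by positivity
  have h1 : R * D ^ 2 ≤ 1 / 2000 := by
    by_contra! h
    nlinarith
  have h2 : R ≤ (N + 1) / 20 := by
    have : R * D ^ 2 ≤ ((N + 1) / 20) * D ^ 2 := by nlinarith
    exact le_of_mul_le_mul_right this (by positivity)
  have h3 : 12 * (L * D) ^ 2 * (2 * N + (2 * reach K + 1) * R) / K ≤ 3 / 10 := by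
    rw [div_le_iff₀ hK0, ← hkK]
    have e1 : L ^ 2 ≤ k ^ 8 := by
      calc L ^ 2 ≤ (k ^ 4) ^ 2 := pow_le_pow_left₀ hL0.le hL4 2
        _ = k ^ 8 := by ring
    have e2 : L ^ 2 * (N * D ^ 2) ≤ k ^ 8 * (1 / 100) :=
      mul_le_mul e1 hND (by positivity) (by positivity)
    have e3 : (2 * reach K + 1) * (L * (R * D ^ 2)) ≤ 5 * k * (1 / 2000 * k) :=
      mul_le_mul (by linarith) hRD (by positivity) (by positivity)
    have e4 : L * ((2 * reach K + 1) * (L * (R * D ^ 2))) ≤ k ^ 4 * (5 * k * (1 / 2000 * k)) :=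
      mul_le_mul hL4 e3 (by positivity) (by positivity)
    have e5 : k ^ 6 ≤ k ^ 8 := pow_le_pow_right₀ hk (by norm_num)
    calc 12 * (L * D) ^ 2 * (2 * N + (2 * reach K + 1) * R)
        = 24 * (L ^ 2 * (N * D ^ 2)) +
          12 * (L * ((2 * reach K + 1) * (L * (R * D ^ 2)))) := by ring
      _ ≤ 24 * (k ^ 8 * (1 / 100)) + 12 * (k ^ 4 * (5 * k * (1 / 2000 * k))) := by linarith
      _ = 24 / 100 * k ^ 8 + 60 / 2000 * k ^ 6 := by ring
      _ ≤ 3 / 10 * k ^ 8 := by linarith [show 0 ≤ k ^ 8 by positivity]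
  have hn0 : (0 : ℝ) ≤ N + 1 := by positivity
  nlinarith

/-- If the regret on the base instance is at least `K ^ (1 / 8) / (2000 D)` after about
`1 / (100 D ^ 2)` rounds, the base instance is hard; otherwise one of the raised instances is. -/
theorem exists_hard_instance (hK : 1 ≤ K) (hD : 0 < D)
    (hKD : (√K + (K : ℝ) ^ (1 / 4 : ℝ)) * D ≤ 1) (π : Policy (Wheel K)) :
    ∃ μ : Wheel K → ℝ, (∀ i, μ i ∈ Set.Icc (0 : ℝ) 1) ∧ (∃! i, IsOptimalArm μ i) ∧
      IsMinGap μ D ∧ 0 < cstar (reinforcedWheel K) μ ∧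
      ∀ T : ℕ, √K / D ^ 2 ≤ T → 1 ≤ Real.log T ∧
        1 / 25000 * (K : ℝ) ^ (1 / 8 : ℝ) / Real.log T ≤
          regret (reinforcedWheel K) μ π T /
            (cstar (reinforcedWheel K) μ * Real.log T + 1 / D) := by
  have hK1 : (1 : ℝ) ≤ K := by exact_mod_cast hK
  obtain ⟨k, hkdef⟩ : ∃ k, k = (K : ℝ) ^ (1 / 8 : ℝ) := ⟨_, rfl⟩
  have hk : 1 ≤ k := hkdef ▸ Real.one_le_rpow hK1 (by norm_num)
  have hpow : ∀ n : ℕ, k ^ n = (K : ℝ) ^ (n / 8 : ℝ) := by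
    intro n
    rw [hkdef, ← Real.rpow_mul_natCast (by positivity)]
    congr 1; ring
  have hk8 : k ^ 8 = K := by rw [hpow]; norm_num
  have hk4 : k ^ 4 = √K := by rw [hpow, Real.sqrt_eq_rpow]; norm_num
  have hk2 : k ^ 2 = (K : ℝ) ^ (1 / 4 : ℝ) := by rw [hpow]; norm_num
  have hm1 : k ≤ reach K := hkdef ▸ Nat.le_ceil _
  have hm2 : (reach K : ℝ) ≤ k + 1 := hkdef ▸ (Nat.ceil_lt_add_one (by positivity)).le
  rw [← hkdef, ← hk4]
  rw [← hk4, ← hk2] at hKD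
  obtain ⟨L, hLdef⟩ : ∃ L, L = (k ^ 4 + k ^ 2) / 2 := ⟨_, rfl⟩
  have h2 : 1 ≤ k ^ 2 := one_le_pow₀ hk
  have h4 : 1 ≤ k ^ 4 := one_le_pow₀ hk
  have hL : 1 ≤ L := by linarith
  have hL0 : 0 < L := by linarith
  have hLk : k ^ 4 / 2 ≤ L := by linarith
  have hLD : 2 * L * D ≤ 1 := by rw [hLdef]; linarith
  have hL1 : K = 1 → L = 1 := by
    intro h
    have : k = 1 := by rw [hkdef, h]; simp
    rw [hLdef, this]; norm_num
  have hD2 : D ≤ 1 / 2 := by nlinarith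
  have hinv : 4 ≤ 1 / D ^ 2 := by
    rw [le_div_iff₀ (by positivity)]; nlinarith
  -- `N + 1` is positive even when `D` is so large that a single round already reveals the instance;
  -- the arm of round `N` depends on the feedback of `N` rounds only.
  obtain ⟨N, hNdef⟩ : ∃ N, N = ⌊1 / 100 / D ^ 2⌋₊ := ⟨_, rfl⟩
  have hN : N ≤ 1 / 100 / D ^ 2 := hNdef ▸ Nat.floor_le (by positivity)
  have hN' : 1 / 100 / D ^ 2 ≤ N + 1 := hNdef ▸ (Nat.lt_floor_add_one _).le
  have hT : ∀ T : ℕ, k ^ 4 / D ^ 2 ≤ T → 1 ≤ Real.log T ∧ N + 1 ≤ T := by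
    intro T hT
    have hT1 : 1 / D ^ 2 ≤ T := le_trans (by gcongr) hT
    refine ⟨?_, ?_⟩
    · rw [Real.le_log_iff_exp_le (by linarith)]
      linarith [Real.exp_one_lt_d9]
    · have : (N + 1 : ℝ) ≤ T := by
        have : 1 / 100 / D ^ 2 = 1 / 100 * (1 / D ^ 2) := by ring
        linarith
      exact_mod_cast this
  -- As the regret is monotone, a lower bound after `N + 1` rounds serves all later `T`. The factor
  -- `b` is `1` for the base instance and `K ^ (3 / 8)` for the raised ones.
  have hratio : ∀ (μ : Wheel K → ℝ) (b : ℝ), 1 ≤ b → 0 < cstar (reinforcedWheel K) μ →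
      cstar (reinforcedWheel K) μ ≤ 10 * b / D →
      11 * b * k / (25000 * D) ≤ regret (reinforcedWheel K) μ π (N + 1) →
      ∀ T : ℕ, k ^ 4 / D ^ 2 ≤ T → 1 ≤ Real.log T ∧
        1 / 25000 * k / Real.log T ≤ regret (reinforcedWheel K) μ π T /
          (cstar (reinforcedWheel K) μ * Real.log T + 1 / D) := by
    intro μ b hb hc0 hc hreg T hT'
    obtain ⟨hlog, hNT⟩ := hT T hT'
    refine ⟨hlog, ?_⟩
    have hlog0 : 0 < Real.log T := by linarith
    have hden : 0 < cstar (reinforcedWheel K) μ * Real.log T + 1 / D := by positivity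
    rw [div_le_div_iff₀ hlog0 hden]
    have hden' : cstar (reinforcedWheel K) μ * Real.log T + 1 / D ≤ 11 * b / D * Real.log T := by
      have e1 := mul_le_mul_of_nonneg_right hc hlog0.le
      have e2 : 1 / D ≤ b / D * Real.log T := by
        rw [div_mul_eq_mul_div]
        gcongr
        nlinarith
      calc _ ≤ 10 * b / D * Real.log T + b / D * Real.log T := add_le_add e1 e2
        _ = _ := by ring
    calc 1 / 25000 * k * (cstar (reinforcedWheel K) μ * Real.log T + 1 / D)
        ≤ 1 / 25000 * k * (11 * b / D * Real.log T) := by gcongr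
      _ = 11 * b * k / (25000 * D) * Real.log T := by field_simp
      _ ≤ regret (reinforcedWheel K) μ π T * Real.log T := by
          gcongr
          exact hreg.trans (regret_mono _ _ _ hNT)
  by_cases hcase : 1 / 2000 * k / D ≤ regret (reinforcedWheel K) (baseMean K L D) π (N + 1)
  · obtain ⟨ho1, ho2⟩ := isOptimalArm_and_unique (baseMean_lt (K := K) hL hD)
    have hc0 := cstar_baseMean_pos hL hD hK
    refine ⟨baseMean K L D, baseMean_mem_Icc hL hD hLD, ⟨hub, ho1, ho2⟩,
      isMinGap_baseMean hL hD hK, hc0, hratio _ 1 le_rfl hc0 ?_ ?_⟩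
    · refine (cstar_baseMean_le hL hD).trans ?_
      rw [div_le_div_iff₀ (by positivity) hD, ← hk8]
      have : (k ^ 4 / 2) ^ 2 ≤ L ^ 2 := pow_le_pow_left₀ (by positivity) hLk 2
      have : k ^ 8 ≤ 4 * L ^ 2 := by nlinarith
      nlinarith
    · refine le_trans ?_ hcase
      have : 0 ≤ k / D := by positivity
      calc 11 * 1 * k / (25000 * D) = 11 / 25000 * (k / D) := by field_simp
        _ ≤ 1 / 2000 * (k / D) := by linarith
        _ = 1 / 2000 * k / D := by ring
  · obtain ⟨i, hi⟩ := exists_peakInfo_le hL hD hK π N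
    obtain ⟨ho1, ho2⟩ := isOptimalArm_and_unique (peakMean_lt hL hD i)
    have hc0 := cstar_peakMean_pos hL hD hL1 i
    refine ⟨peakMean L D i, peakMean_mem_Icc hL hD hLD i, ⟨rim i, ho1, ho2⟩,
      isMinGap_peakMean hL hD hL1 i, hc0, hratio _ (k ^ 3) (one_le_pow₀ hk) hc0 ?_ ?_⟩
    · refine (cstar_peakMean_le hL hD i).trans ?_
      have hdiv : ((K / reach K : ℕ) : ℝ) ≤ k ^ 7 := by
        refine Nat.cast_div_le.trans ?_
        rw [div_le_iff₀ (by linarith), ← hk8]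
        calc k ^ 8 = k ^ 7 * k := by ring
          _ ≤ k ^ 7 * reach K := by gcongr
      have h7 : 1 ≤ k ^ 7 := one_le_pow₀ hk
      rw [div_le_div_iff₀ (by positivity) hD]
      calc (2 * ((K / reach K : ℕ) : ℝ) + 3) * D ≤ 5 * k ^ 7 * D := by
            gcongr; linarith
        _ = 10 * k ^ 3 * (k ^ 4 / 2 * D) := by ring
        _ ≤ 10 * k ^ 3 * (L * D) := by gcongr
    · have hR0 : 0 ≤ rimPlays π L D (N + 1) :=
        Finset.sum_nonneg fun _ _ => Finset.sum_nonneg fun _ _ => measureReal_nonneg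
      have hhalf := half_le_of_rimPlays_le (K := K) hk hk8 hm2 hLdef hD hR0
        ((mul_rimPlays_le_regret hL hD π (N + 1)).trans (not_le.1 hcase).le) hN hN'
      have hinfo : peakInfo π L D N i ≤ 12 * (L * D) ^ 2 *
          (2 * N + (2 * reach K + 1) * rimPlays π L D (N + 1)) / K := by
        refine hi.trans ?_
        gcongr
        exact rimPlays_mono π N.le_succ
      have hreg := le_regret_peakMean hL hD π i N
      calc 11 * k ^ 3 * k / (25000 * D) = 11 / 25000 * (k ^ 4 / D) := by field_simp
        _ ≤ 1 / 400 * (k ^ 4 / D) := by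
            have : 0 ≤ k ^ 4 / D := by positivity
            linarith
        _ = k ^ 4 / 2 * D * (1 / 100 / D ^ 2 / 2) := by field_simp; norm_num
        _ ≤ L * D * ((N + 1) / 2) := by gcongr
        _ ≤ _ := by
            refine le_trans (mul_le_mul_of_nonneg_left (hhalf.trans ?_) (by positivity)) hreg
            have := mul_le_mul_of_nonneg_left hinfo (show (0 : ℝ) ≤ N + 1 by positivity)
            linarith

end Wheel

/-! ### Polynomial growth against the logarithm -/

theorem eventually_mul_log_le (B c : ℝ) {ε : ℝ} (hε : 0 < ε) (hc : 0 < c) :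
    ∀ᶠ K : ℕ in Filter.atTop,
      (|B| + (K : ℝ) ^ (1 / 8 - ε)) * (Real.log 5 + 3 / 2 * Real.log K) ≤
        c * (K : ℝ) ^ (1 / 8 : ℝ) := by
  obtain ⟨r, hr⟩ : ∃ r, r = min ε (1 / 8) := ⟨_, rfl⟩
  have hr0 : 0 < r := hr ▸ lt_min hε (by norm_num)
  have hrε : r ≤ ε := hr ▸ min_le_left _ _
  have hr8 : r ≤ 1 / 8 := hr ▸ min_le_right _ _
  have hB : 0 < |B| + 1 := by positivity
  have hconst : (fun _ : ℝ => Real.log 5) =o[Filter.atTop] fun x : ℝ => x ^ r :=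
    Asymptotics.isLittleO_const_left.2
      (Or.inr (tendsto_norm_atTop_atTop.comp (tendsto_rpow_atTop hr0)))
  have hlog := hconst.add ((isLittleO_log_rpow_atTop hr0).const_mul_left (3 / 2))
  filter_upwards [tendsto_natCast_atTop_atTop.eventually
    (hlog.bound (c := c / (|B| + 1)) (by positivity)), Filter.eventually_ge_atTop 1] with K hK hK1
  have hK1' : (1 : ℝ) ≤ K := by exact_mod_cast hK1
  rw [Real.norm_of_nonneg (by positivity : (0 : ℝ) ≤ (K : ℝ) ^ r)] at hK
  have h1 : |B| + (K : ℝ) ^ (1 / 8 - ε) ≤ (|B| + 1) * (K : ℝ) ^ (1 / 8 - r) := by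
    have h2 : (1 : ℝ) ≤ (K : ℝ) ^ (1 / 8 - r) := Real.one_le_rpow hK1' (by linarith)
    have h3 : (K : ℝ) ^ (1 / 8 - ε) ≤ (K : ℝ) ^ (1 / 8 - r) :=
      Real.rpow_le_rpow_of_exponent_le hK1' (by linarith)
    nlinarith [abs_nonneg B]
  calc (|B| + (K : ℝ) ^ (1 / 8 - ε)) * (Real.log 5 + 3 / 2 * Real.log K)
      ≤ ((|B| + 1) * (K : ℝ) ^ (1 / 8 - r)) * (c / (|B| + 1) * (K : ℝ) ^ r) :=
        mul_le_mul h1 ((le_abs_self _).trans hK)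
          (add_nonneg (Real.log_nonneg (by norm_num)) (mul_nonneg (by norm_num)
            (Real.log_nonneg hK1'))) (by positivity)
    _ = c * ((K : ℝ) ^ (1 / 8 - r) * (K : ℝ) ^ r) := by field_simp
    _ = c * (K : ℝ) ^ (1 / 8 : ℝ) := by
        rw [← Real.rpow_add (by linarith), sub_add_cancel]

end FeedbackGraph

end

open FeedbackGraph

theorem theorem1 :
    (∃ c : ℝ, 0 < c ∧ ∃ C : ℝ, 1 ≤ C ∧
      ∀ (K : ℕ) (Δmin : ℝ), 1 ≤ K → 0 < Δmin →
        (Real.sqrt K + (K : ℝ) ^ (1 / 4 : ℝ)) * Δmin ≤ 1 →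
      ∀ π : Policy (Wheel K),
      ∃ μ : Wheel K → ℝ,
        (∀ i, μ i ∈ Set.Icc (0 : ℝ) 1) ∧ (∃! i, IsOptimalArm μ i) ∧ IsMinGap μ Δmin ∧
        ∀ T : ℕ, C * Real.sqrt K / Δmin ^ 2 ≤ T →
          c * (K : ℝ) ^ (1 / 8 : ℝ) / Real.log T ≤
            regret (reinforcedWheel K) μ π T /
              (cstar (reinforcedWheel K) μ * Real.log T + 1 / Δmin)) ∧
    (∀ (B ε : ℝ), 0 < ε →
      ∃ K₀ : ℕ, ∀ K : ℕ, K₀ ≤ K →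
      ∀ π : Policy (Wheel K),
      ∃ μ : Wheel K → ℝ,
        (∀ i, μ i ∈ Set.Icc (0 : ℝ) 1) ∧ (∃! i, IsOptimalArm μ i) ∧
        0 < cstar (reinforcedWheel K) μ ∧
        ∃ T : ℕ, 2 ≤ T ∧
          (B + (K : ℝ) ^ (1 / 8 - ε)) * (cstar (reinforcedWheel K) μ * Real.log T) ≤
            regret (reinforcedWheel K) μ π T) := by
  refine ⟨⟨1 / 25000, by norm_num, 1, le_rfl, fun K D hK hD hKD π => ?_⟩, fun B ε hε => ?_⟩
  · obtain ⟨μ, h1, h2, h3, -, h5⟩ := Wheel.exists_hard_instance hK hD hKD π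
    exact ⟨μ, h1, h2, h3, fun T hT => (h5 T (by simpa using hT)).2⟩
  · obtain ⟨K₀, hK₀⟩ := Filter.eventually_atTop.1
      ((eventually_mul_log_le B (1 / 25000) hε (by norm_num)).and (Filter.eventually_ge_atTop 1))
    refine ⟨K₀, fun K hKK π => ?_⟩
    obtain ⟨hbig, hK⟩ := hK₀ K hKK
    have hK1 : (1 : ℝ) ≤ K := by exact_mod_cast hK
    have hs1 : 1 ≤ √(K : ℝ) := Real.one_le_sqrt.2 hK1
    have hq1 : 1 ≤ (K : ℝ) ^ (1 / 4 : ℝ) := Real.one_le_rpow hK1 (by norm_num)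
    have hqs : (K : ℝ) ^ (1 / 4 : ℝ) ≤ √K := by
      rw [Real.sqrt_eq_rpow]
      exact Real.rpow_le_rpow_of_exponent_le hK1 (by norm_num)
    obtain ⟨D, hDdef⟩ : ∃ D, D = 1 / (√(K : ℝ) + (K : ℝ) ^ (1 / 4 : ℝ)) := ⟨_, rfl⟩
    have hD : 0 < D := hDdef ▸ by positivity
    obtain ⟨μ, h1, h2, -, h4, h5⟩ := Wheel.exists_hard_instance hK hD
      (by rw [hDdef, mul_one_div_cancel (by positivity)]) π
    have hquot : √K / D ^ 2 = √K * (√K + (K : ℝ) ^ (1 / 4 : ℝ)) ^ 2 := by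
      rw [hDdef]; field_simp
    have hquot_le : √K / D ^ 2 ≤ 4 * √K ^ 3 := by
      rw [hquot]
      calc √K * (√K + (K : ℝ) ^ (1 / 4 : ℝ)) ^ 2 ≤ √K * (√K + √K) ^ 2 := by gcongr
        _ = 4 * √K ^ 3 := by ring
    obtain ⟨hlog, hreg⟩ := h5 ⌈√K / D ^ 2⌉₊ (Nat.le_ceil _)
    set T := ⌈√K / D ^ 2⌉₊
    have hT2 : (2 : ℝ) ≤ T := by
      refine le_trans ?_ (Nat.le_ceil _)
      rw [hquot]
      nlinarith
    have hs3 : 1 ≤ √(K : ℝ) ^ 3 := one_le_pow₀ hs1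
    have hTle : (T : ℝ) ≤ 5 * √K ^ 3 := by
      have := (Nat.ceil_lt_add_one (a := √(K : ℝ) / D ^ 2) (by positivity)).le
      linarith
    have hlogT : Real.log T ≤ Real.log 5 + 3 / 2 * Real.log K := by
      refine (Real.log_le_log (by linarith) hTle).trans_eq ?_
      rw [Real.log_mul (by norm_num) (by positivity), Real.log_pow, Real.log_sqrt (by positivity)]
      push_cast
      ring
    refine ⟨μ, h1, h2, h4, T, by exact_mod_cast hT2, ?_⟩
    have hlog0 : 0 < Real.log T := by linarith
    rw [div_le_div_iff₀ hlog0 (by positivity)] at hreg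
    have hcoef : (B + (K : ℝ) ^ (1 / 8 - ε)) * Real.log T ≤ 1 / 25000 * (K : ℝ) ^ (1 / 8 : ℝ) := by
      refine le_trans ?_ hbig
      have : 0 ≤ |B| + (K : ℝ) ^ (1 / 8 - ε) := by positivity
      gcongr
      exact le_abs_self B
    refine le_of_mul_le_mul_right (le_trans ?_ hreg) hlog0
    calc (B + (K : ℝ) ^ (1 / 8 - ε)) * (cstar (reinforcedWheel K) μ * Real.log T) * Real.log T
        = (B + (K : ℝ) ^ (1 / 8 - ε)) * Real.log T * (cstar (reinforcedWheel K) μ * Real.log T) := by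
          ring
      _ ≤ 1 / 25000 * (K : ℝ) ^ (1 / 8 : ℝ) * (cstar (reinforcedWheel K) μ * Real.log T) := by
          gcongr
      _ ≤ _ := by
          gcongr
          have : 0 < 1 / D := by positivity
          linarith
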